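/- Let $H$ be a commutative Banach ring. Let $\mathcal E$ be one of the categories $\mathrm{Ind}(\mathrm{Ban}_H)$, $\mathrm{Ind}^m(\mathrm{Ban}_H)$ of ind-Banach $H$-modules, respectively essentially monomorphic ind-Banach $H$-modules (formed from all Banach $H$-modules, or from the ultrametric ones only), and let $\mathrm{sComm}(\mathcal E)$ be the category of simplicial commutative algebras in $\mathcal E$ (for the completed tensor product), with its standard model structure, in which a map is a trivial fibration if it induces a trivial Kan fibration on maps out of every projective (equivalently, every free Banach) module. For $R\in\mathrm{sComm}(\mathcal E)$ let $\pi_n(R)$ denote its homotopy objects, computed in $\mathcal E$ as cokernels. In particular $\pi_0(R)$ is the coequalizer of $R_1\rightrightarrows R_0$; ideals of $\pi_0(R)$, and divided power structures on them, are those of its underlying ring, and $\pi_0(R)/I$ is the quotient formed in the category of commutative algebras in $\mathcal E$. For a morphism $A\to B$ in $\mathrm{sComm}(\mathcal E)$ put $X=\mathrm{Spec}\,B$, $Y=\mathrm{Spec}\,A$, so that $X(R)=\mathrm{Map}(B,R)$ and $Y(R)=\mathrm{Map}(A,R)$ are the derived mapping spaces. Define $$Y_{X,\mathrm{dR}}(R)=\varinjlim_{I}\,X(\pi_0(R)/I)\times_{Y(\pi_0(R)/I)}Y(R),\qquad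 Y_{X,\mathrm{crys}}(R)=\varinjlim_{(I,\gamma)}\,X(\pi_0(R)/I)\times_{Y(\pi_0(R)/I)}Y(R),$$ where the fibre products and colimits are taken in spaces (homotopy pullbacks and homotopy colimits), $I$ runs over all nilpotent ideals of $\pi_0(R)$, and $(I,\gamma)$ runs over all nilpotent ideals together with a divided power structure $\gamma$, ordered by $(I,\gamma)\le(J,\delta)$ if $I\subseteq J$ and $\delta$ extends $\gamma$. The morphism is called affinoid if there is a strict surjection $\pi_0(A)\langle X_1,\dots,X_d\rangle\to\pi_0(B)$ of $\pi_0(A)$-algebras for some $d$ (convergent power series with summable coefficients or, in the ultrametric case, with coefficients tending to $0$), and $\pi_0(B)\otimes_{\pi_0(A)}\pi_n(A)\to\pi_n(B)$ is an isomorphism in $\mathcal E$ for all $n$. It is called de Rham intrinsic étale if it is affinoid and the canonical map $\pi_0(X(R))\to\pi_0(Y_{X,\mathrm{dR}}(R))$ is bijective for all $R\in\mathrm{sComm}(\mathcal E)$, and PD intrinsic étale if it is affinoid and the canonical map $\pi_0(X(R))\to\pi_0(Y_{X,\mathrm{crys}}(R))$ is bijective for all $R\in\mathrm{sComm}(\mathcal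 E)$. Then every de Rham intrinsic étale morphism is a PD intrinsic étale morphism. -/

import Mathlib

open CategoryTheory Opposite Simplicial MonoidalCategory
open scoped NNReal

universe u

namespace IndBanach

/-! ## Normed sets and bounded functions -/

/-- A normed set: a set `S` with a weight `w : S → ℝ≥0`. It indexes the free Banach `H`-module
on `S` with `‖s‖ = w s` (the completed weighted `ℓ¹`-sum of copies of `H`, or the weighted
`c₀`-sum in the non-Archimedean setting). -/
structure NSet : Type (u + 1) where
  carrier : Type u
  w : carrier → ℝ≥0

namespace NSet

/-- Bounded maps of normed sets. -/
@[ext]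
structure Map (S T : NSet.{u}) where
  toFun : S.carrier → T.carrier
  bdd : ∃ C : ℝ≥0, ∀ s, T.w (toFun s) ≤ C * S.w s

def Map.id (S : NSet.{u}) : Map S S := ⟨fun s => s, 1, fun s => by simp⟩

def Map.comp {S T U : NSet.{u}} (g : Map T U) (f : Map S T) : Map S U :=
  ⟨fun s => g.toFun (f.toFun s), by
    obtain ⟨C, hC⟩ := f.bdd
    obtain ⟨D, hD⟩ := g.bdd
    refine ⟨D * C, fun s => (hD _).trans ?_⟩
    rw [mul_assoc]
    exact mul_le_mul_right (hC s) D⟩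

/-- The one-point set of weight `1`; the free Banach module on it is `H`. -/
def pt : NSet.{u} := ⟨PUnit, fun _ => 1⟩

/-- The product with multiplied weights; free Banach modules turn it into the completed tensor
product. -/
def prod (S T : NSet.{u}) : NSet.{u} := ⟨S.carrier × T.carrier, fun x => S.w x.1 * T.w x.2⟩

def Map.prodMap {S T S' T' : NSet.{u}} (f : Map S S') (g : Map T T') :
    Map (S.prod T) (S'.prod T') :=
  ⟨fun x => (f.toFun x.1, g.toFun x.2), by
    obtain ⟨C, hC⟩ := f.bdd
    obtain ⟨D, hD⟩ := g.bdd
    refine ⟨C * D, fun x => ?_⟩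
    calc S'.w (f.toFun x.1) * T'.w (g.toFun x.2) ≤ (C * S.w x.1) * (D * T.w x.2) :=
          mul_le_mul' (hC _) (hD _)
      _ = C * D * (S.w x.1 * T.w x.2) := by ring⟩

def Map.swap (S T : NSet.{u}) : Map (S.prod T) (T.prod S) :=
  ⟨fun x => (x.2, x.1), 1, fun x => by simp [prod, mul_comm]⟩

def Map.assoc (S T U : NSet.{u}) : Map ((S.prod T).prod U) (S.prod (T.prod U)) :=
  ⟨fun x => (x.1.1, (x.1.2, x.2)), 1, fun x => by simp [prod, mul_assoc]⟩

def Map.leftUnit (S : NSet.{u}) : Map (pt.prod S) S :=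
  ⟨fun x => x.2, 1, fun x => by simp [prod, pt]⟩

/-- The diagonal of the point. -/
def Map.diagPt : Map pt.{u} (pt.prod pt) :=
  ⟨fun _ => (PUnit.unit, PUnit.unit), 1, fun _ => by simp [prod, pt]⟩

end NSet

open NSet

/-- Bounded functions from a normed set to a normed group: `‖f s‖ ≤ C * w s`. For a Banach
`H`-module `V` these are the bounded linear maps from the free Banach module on `S` to `V`. -/
def Bdd (S : NSet.{u}) (V : Type u) [NormedAddCommGroup V] : AddSubgroup (S.carrier → V) where
  carrier := {f | ∃ C : ℝ≥0, ∀ s, ‖f s‖ ≤ C * S.w s}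
  zero_mem' := ⟨0, fun s => by simp⟩
  add_mem' := by
    rintro f g ⟨C, hC⟩ ⟨D, hD⟩
    refine ⟨C + D, fun s => (norm_add_le _ _).trans ?_⟩
    push_cast
    nlinarith [hC s, hD s]
  neg_mem' := by
    rintro f ⟨C, hC⟩
    exact ⟨C, fun s => by simpa using hC s⟩

/-- Restriction of bounded functions along a bounded map. -/
def Bdd.comp {S T : NSet.{u}} {V : Type u} [NormedAddCommGroup V] (f : Bdd T V) (g : Map S T) :
    Bdd S V :=
  ⟨fun s => f.1 (g.toFun s), by
    obtain ⟨C, hC⟩ := f.2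
    obtain ⟨D, hD⟩ := g.bdd
    refine ⟨C * D, fun s => (hC _).trans ?_⟩
    rw [NNReal.coe_mul, mul_assoc]
    exact mul_le_mul_of_nonneg_left (by exact_mod_cast hD s) C.2⟩

/-- The function `(t, s) ↦ b t • x s`. -/
def Bdd.smul {H : Type u} [NormedCommRing H] {S T : NSet.{u}} {V : Type u}
    [NormedAddCommGroup V] [Module H V] [IsBoundedSMul H V] (b : Bdd T H) (x : Bdd S V) :
    Bdd (T.prod S) V :=
  ⟨fun p => b.1 p.1 • x.1 p.2, by
    obtain ⟨C, hC⟩ := b.2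
    obtain ⟨D, hD⟩ := x.2
    refine ⟨C * D, fun p => (norm_smul_le _ _).trans ?_⟩
    calc ‖b.1 p.1‖ * ‖x.1 p.2‖ ≤ (C * T.w p.1) * (D * S.w p.2) :=
          mul_le_mul (hC _) (hD _) (norm_nonneg _) (by positivity)
      _ = ((C * D : ℝ≥0) : ℝ) * ((T.prod S).w p : ℝ) := by simp [NSet.prod]; ring⟩

/-- The function `1` on the point. -/
def Bdd.one (H : Type u) [NormedCommRing H] : Bdd pt.{u} H :=
  ⟨fun _ => 1, ‖(1 : H)‖₊, fun _ => by simp [pt]⟩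

/-- Postcomposition with a bounded linear map. -/
def Bdd.push {H : Type u} [NormedCommRing H] {S : NSet.{u}} {V W : Type u}
    [NormedAddCommGroup V] [Module H V] [NormedAddCommGroup W] [Module H W]
    (φ : V →ₗ[H] W) (hφ : ∃ C : ℝ≥0, ∀ v, ‖φ v‖ ≤ C * ‖v‖) (f : Bdd S V) : Bdd S W :=
  ⟨fun s => φ (f.1 s), by
    obtain ⟨C, hC⟩ := hφ
    obtain ⟨D, hD⟩ := f.2
    refine ⟨C * D, fun s => (hC _).trans ?_⟩
    rw [NNReal.coe_mul, mul_assoc]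
    exact mul_le_mul_of_nonneg_left (hD s) C.2⟩

/-! ## Ind-Banach modules

An ind-Banach module `M = "colim" M i` is recorded by its functor of points on free Banach
modules, `S ↦ M(S) = Hom(Free S, M) = colim_i Bdd S (M i)`, with the external action of the
points of `H`. The free Banach modules are projective and every ind-Banach module is a strict
quotient of a coproduct of them; the functor of points identifies `Ind(Ban_H)` with a full
subcategory of the category of the presheaves `PreMod H`, and multilinear maps of ind-Banach
modules with natural multilinear external products. `PreMod` is only the ambient category; the
ind-Banach modules are the objects that satisfy `IsInd` below. -/

/-- Presheaves of abelian groups on normed sets with an external action of the points of `H`. -/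
structure PreMod (H : Type u) [NormedCommRing H] : Type (u + 1) where
  pts : NSet.{u} → Type u
  [grp : ∀ S, AddCommGroup (pts S)]
  pull : ∀ {S T : NSet.{u}}, Map S T → pts T →+ pts S
  pull_id : ∀ {S : NSet.{u}} (x : pts S), pull (Map.id S) x = x
  pull_comp : ∀ {S T U : NSet.{u}} (g : Map T U) (f : Map S T) (x : pts U),
    pull (g.comp f) x = pull f (pull g x)
  act : ∀ {T S : NSet.{u}}, Bdd T H →+ pts S →+ pts (T.prod S)
  act_pull : ∀ {T S T' S' : NSet.{u}} (g : Map T' T) (f : Map S' S) (b : Bdd T H) (x : pts S),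
    pull (g.prodMap f) (act b x) = act (Bdd.comp b g) (pull f x)
  act_act : ∀ {T T' S : NSet.{u}} (b : Bdd T H) (c : Bdd T' H) (x : pts S),
    act (Bdd.smul b c) x = pull (Map.assoc T T' S) (act b (act c x))
  one_act : ∀ {S : NSet.{u}} (x : pts S), act (Bdd.one H) x = pull (Map.leftUnit S) x

attribute [instance] PreMod.grp

variable {H : Type u} [NormedCommRing H]

/-- Morphisms of `PreMod`; between ind-Banach modules these are exactly the morphisms of
`Ind(Ban_H)`. -/
@[ext]
structure PreMod.Hom (M N : PreMod.{u} H) where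
  app : ∀ S, M.pts S →+ N.pts S
  app_pull : ∀ {S T : NSet.{u}} (f : Map S T) (x : M.pts T),
    app S (M.pull f x) = N.pull f (app T x)
  app_act : ∀ {T S : NSet.{u}} (b : Bdd T H) (x : M.pts S),
    app _ (M.act b x) = N.act b (app S x)

/-- Which category of ind-objects is used: all ind-objects (`monomorphic = false`) or the
essentially monomorphic ones (`monomorphic = true`), of all Banach `H`-modules
(`nonarch = false`) or of the ultrametric ones (`nonarch = true`). -/
structure Kind where
  monomorphic : Bool
  nonarch : Bool

variable (H) in
/-- Banach modules over the Banach ring `H`. -/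
structure BanMod : Type (u + 1) where
  carrier : Type u
  [normed : NormedAddCommGroup carrier]
  [module : Module H carrier]
  [bddSMul : IsBoundedSMul H carrier]
  [complete : CompleteSpace carrier]

attribute [instance] BanMod.normed BanMod.module BanMod.bddSMul BanMod.complete

/-- A presentation of `M` as a filtered colimit `"colim" (obj i)` of Banach `H`-modules and
bounded linear maps; in the essentially monomorphic case the transition maps are injective. -/
structure IndPresentation (κ : Kind) (M : PreMod.{u} H) : Type (u + 1) where
  J : Type u
  [pre : Preorder J]
  [dir : IsDirected J (· ≤ ·)]
  [ne : Nonempty J]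
  obj : J → BanMod.{u} H
  tr : ∀ {i j : J}, i ≤ j → (obj i).carrier →ₗ[H] (obj j).carrier
  tr_bdd : ∀ {i j : J} (h : i ≤ j), ∃ C : ℝ≥0, ∀ v, ‖tr h v‖ ≤ C * ‖v‖
  tr_id : ∀ (i : J) (v), tr (le_refl i) v = v
  tr_comp : ∀ {i j k : J} (h : i ≤ j) (h' : j ≤ k) (v), tr h' (tr h v) = tr (h.trans h') v
  tr_inj : κ.monomorphic = true → ∀ {i j : J} (h : i ≤ j), Function.Injective (tr h)
  ultra : κ.nonarch = true → ∀ i, IsUltrametricDist (obj i).carrier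
  of : ∀ (i : J) {S : NSet.{u}}, Bdd S (obj i).carrier →+ M.pts S
  of_tr : ∀ {i j : J} (h : i ≤ j) {S : NSet.{u}} (x : Bdd S (obj i).carrier),
    of j (Bdd.push (tr h) (tr_bdd h) x) = of i x
  of_pull : ∀ (i : J) {S T : NSet.{u}} (f : Map S T) (x : Bdd T (obj i).carrier),
    M.pull f (of i x) = of i (Bdd.comp x f)
  of_act : ∀ (i : J) {T S : NSet.{u}} (b : Bdd T H) (x : Bdd S (obj i).carrier),
    M.act b (of i x) = of i (Bdd.smul b x)
  of_surj : ∀ {S : NSet.{u}} (y : M.pts S), ∃ i, ∃ x : Bdd S (obj i).carrier, of i x = y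
  of_eq_zero : ∀ (i : J) {S : NSet.{u}} (x : Bdd S (obj i).carrier), of i x = 0 →
    ∃ (j : J) (h : i ≤ j), Bdd.push (tr h) (tr_bdd h) x = 0

/-- `M` is an (essentially monomorphic) ind-Banach module over `H`. -/
def IsInd (κ : Kind) (M : PreMod.{u} H) : Prop := Nonempty (IndPresentation κ M)

/-! ## Subobjects and quotients -/

/-- Subpresheaves. -/
@[ext]
structure PreMod.Sub (M : PreMod.{u} H) where
  carrier : ∀ S, AddSubgroup (M.pts S)
  pull_mem : ∀ {S T : NSet.{u}} (f : Map S T) {x : M.pts T}, x ∈ carrier T →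
    M.pull f x ∈ carrier S
  act_mem : ∀ {T S : NSet.{u}} (b : Bdd T H) {x : M.pts S}, x ∈ carrier S →
    M.act b x ∈ carrier (T.prod S)

/-- A subpresheaf as an object. -/
def PreMod.Sub.toPreMod {M : PreMod.{u} H} (K : M.Sub) : PreMod.{u} H where
  pts S := K.carrier S
  pull f := AddMonoidHom.codRestrict ((M.pull f).comp (K.carrier _).subtype) (K.carrier _)
    (fun x => K.pull_mem f x.2)
  pull_id x := Subtype.ext (M.pull_id x.1)
  pull_comp g f x := Subtype.ext (M.pull_comp g f x.1)
  act := AddMonoidHom.mk'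
    (fun b => AddMonoidHom.codRestrict ((M.act b).comp (K.carrier _).subtype) (K.carrier _)
      (fun x => K.act_mem b x.2))
    (fun b c => by
      ext x
      simp)
  act_pull g f b x := Subtype.ext (M.act_pull g f b x.1)
  act_act b c x := Subtype.ext (M.act_act b c x.1)
  one_act x := Subtype.ext (M.one_act x.1)

/-- The quotient `M/K`, with `(M/K)(S) = M(S)/K(S)`. -/
def PreMod.quot (M : PreMod.{u} H) (K : M.Sub) : PreMod.{u} H where
  pts S := M.pts S ⧸ K.carrier S
  pull f := QuotientAddGroup.map _ _ (M.pull f) (fun _ hx => K.pull_mem f hx)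
  pull_id x := by
    induction x using QuotientAddGroup.induction_on with
    | H x => exact congrArg _ (M.pull_id x)
  pull_comp g f x := by
    induction x using QuotientAddGroup.induction_on with
    | H x => exact congrArg _ (M.pull_comp g f x)
  act := AddMonoidHom.mk'
    (fun b => QuotientAddGroup.map _ _ (M.act b) (fun _ hx => K.act_mem b hx))
    (fun b c => by
      ext x
      change QuotientAddGroup.mk (M.act (b + c) x) = QuotientAddGroup.mk (M.act b x + M.act c x)
      rw [map_add, AddMonoidHom.add_apply])
  act_pull g f b x := by
    induction x using QuotientAddGroup.induction_on with
    | H x => exact congrArg _ (M.act_pull g f b x)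
  act_act b c x := by
    induction x using QuotientAddGroup.induction_on with
    | H x => exact congrArg _ (M.act_act b c x)
  one_act x := by
    induction x using QuotientAddGroup.induction_on with
    | H x => exact congrArg _ (M.one_act x)

/-- `K` is a closed (strict) subobject: the quotient is ind-Banach. -/
def PreMod.Sub.IsClosed (κ : Kind) {M : PreMod.{u} H} (K : M.Sub) : Prop := IsInd κ (M.quot K)

/-- The smallest closed subobject that contains a family of points. The quotient by it is the
cokernel formed in the category of ind-Banach modules. -/
def PreMod.closedSpan (κ : Kind) (M : PreMod.{u} H) (X : ∀ S, Set (M.pts S)) : M.Sub where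
  carrier S := ⨅ K : {K : M.Sub // K.IsClosed κ ∧ ∀ S, X S ⊆ K.carrier S}, K.1.carrier S
  pull_mem f x hx := by
    rw [AddSubgroup.mem_iInf] at hx ⊢
    exact fun K => K.1.pull_mem f (hx K)
  act_mem b x hx := by
    rw [AddSubgroup.mem_iInf] at hx ⊢
    exact fun K => K.1.act_mem b (hx K)

/-! ## Commutative algebras -/

variable (H) in
/-- Commutative algebra objects: a commutative, associative, unital, natural and `H`-bilinear
external product. If the underlying presheaf is an ind-Banach module, then such a product is the
same as a commutative algebra structure for the completed tensor product of `Ind(Ban_H)`. -/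
structure PreAlg : Type (u + 1) extends PreMod.{u} H where
  mul : ∀ {S T : NSet.{u}}, pts S →+ pts T →+ pts (S.prod T)
  one : pts pt
  mul_pull : ∀ {S T S' T' : NSet.{u}} (f : Map S' S) (g : Map T' T) (x : pts S) (y : pts T),
    pull (f.prodMap g) (mul x y) = mul (pull f x) (pull g y)
  act_mul : ∀ {U S T : NSet.{u}} (b : Bdd U H) (x : pts S) (y : pts T),
    mul (act b x) y = pull (Map.assoc U S T) (act b (mul x y))
  mul_comm : ∀ {S T : NSet.{u}} (x : pts S) (y : pts T),
    mul y x = pull (Map.swap T S) (mul x y)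
  mul_assoc : ∀ {S T U : NSet.{u}} (x : pts S) (y : pts T) (z : pts U),
    mul (mul x y) z = pull (Map.assoc S T U) (mul x (mul y z))
  one_mul : ∀ {S : NSet.{u}} (x : pts S), mul one x = pull (Map.leftUnit S) x

/-- Morphisms of commutative algebra objects. -/
@[ext]
structure PreAlg.Hom (A B : PreAlg.{u} H) extends PreMod.Hom A.toPreMod B.toPreMod where
  app_one : app _ A.one = B.one
  app_mul : ∀ {S T : NSet.{u}} (x : A.pts S) (y : A.pts T),
    app _ (A.mul x y) = B.mul (app S x) (app T y)

instance : Category.{u + 1} (PreAlg.{u} H) where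
  Hom A B := PreAlg.Hom A B
  id A :=
    { app := fun S => AddMonoidHom.id _
      app_pull := fun _ _ => rfl
      app_act := fun _ _ => rfl
      app_one := rfl
      app_mul := fun _ _ => rfl }
  comp f g :=
    { app := fun S => (g.app S).comp (f.app S)
      app_pull := fun p x => by simp [f.app_pull, g.app_pull]
      app_act := fun b x => by simp [f.app_act, g.app_act]
      app_one := by simp [f.app_one, g.app_one]
      app_mul := fun x y => by simp [f.app_mul, g.app_mul] }

/-- Evaluation at `S`, as a functor to sets. -/
def PreAlg.evalFunctor (S : NSet.{u}) : PreAlg.{u} H ⥤ Type u where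
  obj A := A.pts S
  map f := ↾fun x => PreMod.Hom.app (PreAlg.Hom.toHom f) S x

/-- Ideals. -/
@[ext]
structure PreAlg.Idl (A : PreAlg.{u} H) extends PreMod.Sub A.toPreMod where
  mul_mem : ∀ {S T : NSet.{u}} {x : A.pts S} (y : A.pts T), x ∈ carrier S →
    A.mul x y ∈ carrier (S.prod T)

theorem PreAlg.Idl.mul_mem' {A : PreAlg.{u} H} (K : A.Idl) {S T : NSet.{u}} (x : A.pts S)
    {y : A.pts T} (hy : y ∈ K.carrier T) : A.mul x y ∈ K.carrier (S.prod T) := by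
  rw [A.mul_comm y x]
  exact K.pull_mem _ (K.mul_mem x hy)

/-- The quotient algebra `A/K`. -/
def PreAlg.quot (A : PreAlg.{u} H) (K : A.Idl) : PreAlg.{u} H where
  toPreMod := A.toPreMod.quot K.toSub
  mul {S T} := QuotientAddGroup.lift (K.carrier S)
    (AddMonoidHom.mk' (fun x => QuotientAddGroup.map (K.carrier T) (K.carrier (S.prod T))
      (A.mul x) (fun _ hy => K.mul_mem' x hy)) (fun x y => by
        ext z
        induction z using QuotientAddGroup.induction_on with
        | H z =>
          change QuotientAddGroup.mk (A.mul (x + y) z) =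
            QuotientAddGroup.mk (A.mul x z + A.mul y z)
          rw [map_add, AddMonoidHom.add_apply]))
    (fun x hx => by
      ext y
      induction y using QuotientAddGroup.induction_on with
      | H y => exact (QuotientAddGroup.eq_zero_iff _).2 (K.mul_mem (x := x) y hx))
  one := QuotientAddGroup.mk A.one
  mul_pull f g x y := by
    induction x using QuotientAddGroup.induction_on with
    | H x =>
      induction y using QuotientAddGroup.induction_on with
      | H y => exact congrArg _ (A.mul_pull f g x y)
  act_mul b x y := by
    induction x using QuotientAddGroup.induction_on with
    | H x =>
      induction y using QuotientAddGroup.induction_on with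
      | H y => exact congrArg _ (A.act_mul b x y)
  mul_comm x y := by
    induction x using QuotientAddGroup.induction_on with
    | H x =>
      induction y using QuotientAddGroup.induction_on with
      | H y => exact congrArg _ (A.mul_comm x y)
  mul_assoc x y z := by
    induction x using QuotientAddGroup.induction_on with
    | H x =>
      induction y using QuotientAddGroup.induction_on with
      | H y =>
        induction z using QuotientAddGroup.induction_on with
        | H z => exact congrArg _ (A.mul_assoc x y z)
  one_mul x := by
    induction x using QuotientAddGroup.induction_on with
    | H x => exact congrArg _ (A.one_mul x)

/-- The projection `A ⟶ A/K`. -/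
def PreAlg.proj (A : PreAlg.{u} H) (K : A.Idl) : A ⟶ A.quot K :=
  PreAlg.Hom.mk
    { app := fun S => QuotientAddGroup.mk' (K.carrier S)
      app_pull := fun _ _ => rfl
      app_act := fun _ _ => rfl } rfl (fun _ _ => rfl)

/-- The projection `A/K ⟶ A/L` for `K ⊆ L`. -/
def PreAlg.quotMap (A : PreAlg.{u} H) (K L : A.Idl) (h : ∀ S, K.carrier S ≤ L.carrier S) :
    A.quot K ⟶ A.quot L :=
  PreAlg.Hom.mk
    { app := fun S => QuotientAddGroup.map _ _ (AddMonoidHom.id _) (h S)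
      app_pull := fun f x => by
        induction x using QuotientAddGroup.induction_on with
        | H x => rfl
      app_act := fun b x => by
        induction x using QuotientAddGroup.induction_on with
        | H x => rfl } rfl (fun x y => by
        induction x using QuotientAddGroup.induction_on with
        | H x =>
          induction y using QuotientAddGroup.induction_on with
          | H y => rfl)

theorem PreAlg.proj_quotMap (A : PreAlg.{u} H) (K L : A.Idl)
    (h : ∀ S, K.carrier S ≤ L.carrier S) : A.proj K ≫ A.quotMap K L h = A.proj L := rfl

theorem PreAlg.quotMap_id (A : PreAlg.{u} H) (K : A.Idl) (h : ∀ S, K.carrier S ≤ K.carrier S) :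
    A.quotMap K K h = 𝟙 (A.quot K) := by
  apply PreAlg.Hom.ext
  funext S
  refine AddMonoidHom.ext fun x => ?_
  induction x using QuotientAddGroup.induction_on with
  | H x => rfl

theorem PreAlg.quotMap_comp (A : PreAlg.{u} H) (K L M : A.Idl)
    (h : ∀ S, K.carrier S ≤ L.carrier S) (h' : ∀ S, L.carrier S ≤ M.carrier S)
    (h'' : ∀ S, K.carrier S ≤ M.carrier S) :
    A.quotMap K M h'' = A.quotMap K L h ≫ A.quotMap L M h' := by
  apply PreAlg.Hom.ext
  funext S
  refine AddMonoidHom.ext fun x => ?_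
  induction x using QuotientAddGroup.induction_on with
  | H x => rfl

/-- The smallest closed ideal that contains a family of points. The quotient by it is the
quotient formed in the category of ind-Banach algebras. -/
def PreAlg.closedSpan (κ : Kind) (A : PreAlg.{u} H) (X : ∀ S, Set (A.pts S)) : A.Idl where
  carrier S := ⨅ K : {K : A.Idl // K.IsClosed κ ∧ ∀ S, X S ⊆ K.carrier S}, K.1.carrier S
  pull_mem f x hx := by
    rw [AddSubgroup.mem_iInf] at hx ⊢
    exact fun K => K.1.pull_mem f (hx K)
  act_mem b x hx := by
    rw [AddSubgroup.mem_iInf] at hx ⊢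
    exact fun K => K.1.act_mem b (hx K)
  mul_mem y hx := by
    rw [AddSubgroup.mem_iInf] at hx ⊢
    exact fun K => K.1.mul_mem y (hx K)

/-- The underlying ring `Hom(H, A)` of an algebra object. -/
def PreAlg.Ring (A : PreAlg.{u} H) : Type u := A.pts pt

instance (A : PreAlg.{u} H) : AddCommGroup A.Ring := inferInstanceAs (AddCommGroup (A.pts pt))

theorem PreAlg.ring_one_mul (A : PreAlg.{u} H) (x : A.pts pt) :
    A.pull Map.diagPt (A.mul A.one x) = x := by
  rw [A.one_mul, ← A.pull_comp]
  exact A.pull_id x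

theorem PreAlg.ring_mul_comm (A : PreAlg.{u} H) (x y : A.pts pt) :
    A.pull Map.diagPt (A.mul x y) = A.pull Map.diagPt (A.mul y x) := by
  rw [A.mul_comm y x, ← A.pull_comp]
  rfl

theorem PreAlg.ring_mul_assoc (A : PreAlg.{u} H) (x y z : A.pts pt) :
    A.pull Map.diagPt (A.mul (A.pull Map.diagPt (A.mul x y)) z) =
      A.pull Map.diagPt (A.mul x (A.pull Map.diagPt (A.mul y z))) := by
  have h1 : A.mul (A.pull Map.diagPt (A.mul x y)) z =
      A.pull (Map.diagPt.prodMap (Map.id pt)) (A.mul (A.mul x y) z) := by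
    rw [A.mul_pull, A.pull_id]
  have h2 : A.mul x (A.pull Map.diagPt (A.mul y z)) =
      A.pull ((Map.id pt).prodMap Map.diagPt) (A.mul x (A.mul y z)) := by
    rw [A.mul_pull, A.pull_id]
  rw [h1, h2, A.mul_assoc, ← A.pull_comp, ← A.pull_comp, ← A.pull_comp]
  rfl

theorem PreAlg.ring_mul_add (A : PreAlg.{u} H) (x y z : A.pts pt) :
    A.pull Map.diagPt (A.mul x (y + z)) =
      A.pull Map.diagPt (A.mul x y) + A.pull Map.diagPt (A.mul x z) := by
  rw [map_add, map_add]

theorem PreAlg.ring_add_mul (A : PreAlg.{u} H) (x y z : A.pts pt) :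
    A.pull Map.diagPt (A.mul (x + y) z) =
      A.pull Map.diagPt (A.mul x z) + A.pull Map.diagPt (A.mul y z) := by
  rw [map_add, AddMonoidHom.add_apply, map_add]

theorem PreAlg.ring_zero_mul (A : PreAlg.{u} H) (x : A.pts pt) :
    A.pull Map.diagPt (A.mul (0 : A.pts pt) x) = 0 := by
  rw [map_zero, AddMonoidHom.zero_apply, map_zero]

theorem PreAlg.ring_mul_zero (A : PreAlg.{u} H) (x : A.pts pt) :
    A.pull Map.diagPt (A.mul x (0 : A.pts pt)) = 0 := by
  rw [map_zero, map_zero]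

instance (A : PreAlg.{u} H) : CommRing A.Ring :=
  { (inferInstance : AddCommGroup A.Ring) with
    mul := fun x y => A.pull Map.diagPt (A.mul (S := pt) (T := pt) x y)
    one := A.one
    left_distrib := fun x y z => A.ring_mul_add x y z
    right_distrib := fun x y z => A.ring_add_mul x y z
    zero_mul := fun x => A.ring_zero_mul x
    mul_zero := fun x => A.ring_mul_zero x
    mul_assoc := fun x y z => A.ring_mul_assoc x y z
    one_mul := fun x => A.ring_one_mul x
    mul_one := fun x => (A.ring_mul_comm x A.one).trans (A.ring_one_mul x)
    mul_comm := fun x y => A.ring_mul_comm x y }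

/-- The family of points generated by an ideal `I` of the underlying ring. -/
def PreAlg.idealPoints (A : PreAlg.{u} H) (I : Ideal A.Ring) (S : NSet.{u}) : Set (A.pts S) :=
  {x | ∃ y ∈ I, ∃ f : Map S pt, A.pull f y = x}

/-- The closed ideal generated by `I`. -/
def PreAlg.closedIdeal (κ : Kind) (A : PreAlg.{u} H) (I : Ideal A.Ring) : A.Idl :=
  A.closedSpan κ (A.idealPoints I)

theorem PreAlg.closedIdeal_mono (κ : Kind) (A : PreAlg.{u} H) {I J : Ideal A.Ring} (h : I ≤ J)
    (S : NSet.{u}) : (A.closedIdeal κ I).carrier S ≤ (A.closedIdeal κ J).carrier S := by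
  intro x hx
  change x ∈ ⨅ K : {K : A.Idl // K.IsClosed κ ∧ ∀ S, A.idealPoints I S ⊆ K.carrier S}, _ at hx
  change x ∈ ⨅ K : {K : A.Idl // K.IsClosed κ ∧ ∀ S, A.idealPoints J S ⊆ K.carrier S}, _
  rw [AddSubgroup.mem_iInf] at hx ⊢
  intro K
  refine hx ⟨K.1, K.2.1, fun S y hy => K.2.2 S ?_⟩
  obtain ⟨z, hz, f, rfl⟩ := hy
  exact ⟨z, h hz, f, rfl⟩

/-- The quotient `A/I`, formed in the category of ind-Banach algebras: the largest ind-Banach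
quotient algebra of `A` in which the elements of `I` vanish. -/
def PreAlg.modIdeal (κ : Kind) (A : PreAlg.{u} H) (I : Ideal A.Ring) : PreAlg.{u} H :=
  A.quot (A.closedIdeal κ I)

/-- The functor `I ↦ A/I`. -/
def PreAlg.modIdealFunctor (κ : Kind) (A : PreAlg.{u} H) : Ideal A.Ring ⥤ PreAlg.{u} H where
  obj I := A.modIdeal κ I
  map h := A.quotMap _ _ (A.closedIdeal_mono κ (leOfHom h))
  map_id _ := A.quotMap_id _ _
  map_comp _ _ := A.quotMap_comp _ _ _ _ _ _

/-! ## Simplicial commutative ind-Banach algebras and their homotopy groups -/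

/-- Simplicial objects in the category of ambient algebra objects. -/
abbrev SPre (H : Type u) [NormedCommRing H] := SimplicialObject (PreAlg.{u} H)

/-- The simplicial object is levelwise ind-Banach, that is, it is a simplicial commutative
ind-Banach algebra. -/
def IsSimpInd (κ : Kind) (R : SPre.{u} H) : Prop := ∀ n, IsInd κ (R.obj n).toPreMod

/-- The structure map `R_n(S) → R_m(S)` of an operator `[m] → [n]`. -/
def pt_map (R : SPre.{u} H) {m n : SimplexCategory} (θ : m ⟶ n) (S : NSet.{u}) :
    (R.obj (op n)).pts S →+ (R.obj (op m)).pts S :=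
  (PreAlg.Hom.toHom (R.map θ.op)).app S

theorem pt_map_comp (R : SPre.{u} H) {l m n : SimplexCategory} (θ : l ⟶ m) (η : m ⟶ n)
    (S : NSet.{u}) (x : (R.obj (op n)).pts S) :
    pt_map R (θ ≫ η) S x = pt_map R θ S (pt_map R η S x) := by
  have h : R.map (θ ≫ η).op = R.map η.op ≫ R.map θ.op := R.map_comp η.op θ.op
  unfold pt_map
  rw [h]
  rfl

/-- The points `d₀ y - d₁ y` of `R₀`. -/
def zeroBoundaries (R : SPre.{u} H) (S : NSet.{u}) : Set ((R.obj (op ⦋0⦌)).pts S) :=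
  {x | ∃ y : (R.obj (op ⦋1⦌)).pts S,
    x = pt_map R (SimplexCategory.δ 0) S y - pt_map R (SimplexCategory.δ 1) S y}

/-- The closed ideal of `R₀` generated by all `d₀ y - d₁ y`. -/
def zeroIdeal (κ : Kind) (R : SPre.{u} H) : (R.obj (op ⦋0⦌)).Idl :=
  (R.obj (op ⦋0⦌)).closedSpan κ (zeroBoundaries R)

/-- `π₀(R)`, the coequalizer of `d₀, d₁ : R₁ ⇉ R₀` in the category of ind-Banach algebras. -/
def piZero (κ : Kind) (R : SPre.{u} H) : PreAlg.{u} H := (R.obj (op ⦋0⦌)).quot (zeroIdeal κ R)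

/-- The projection `R₀ ⟶ π₀(R)`. -/
def piZeroProj (κ : Kind) (R : SPre.{u} H) : R.obj (op ⦋0⦌) ⟶ piZero κ R :=
  (R.obj (op ⦋0⦌)).proj (zeroIdeal κ R)

/-- Cycles of degree `n`: the points of `R_n` all of whose restrictions to lower-dimensional
simplices vanish. -/
def cycles (R : SPre.{u} H) (n : ℕ) : (R.obj (op ⦋n⦌)).toPreMod.Sub where
  carrier S := ⨅ (m : ℕ) (_ : m < n) (θ : ⦋m⦌ ⟶ ⦋n⦌), (pt_map R θ S).ker
  pull_mem f x hx := by
    simp only [AddSubgroup.mem_iInf, AddMonoidHom.mem_ker] at hx ⊢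
    intro m hm θ
    have := (PreAlg.Hom.toHom (R.map θ.op)).app_pull f x
    simp only [pt_map] at hx ⊢
    rw [this, hx m hm θ, map_zero]
  act_mem b x hx := by
    simp only [AddSubgroup.mem_iInf, AddMonoidHom.mem_ker] at hx ⊢
    intro m hm θ
    have := (PreAlg.Hom.toHom (R.map θ.op)).app_act b x
    simp only [pt_map] at hx ⊢
    rw [this, hx m hm θ, map_zero]

/-- Boundaries of degree `n`: the points `d₀ y` with `y` in `R_{n+1}` and `d_i y = 0` for
all `i ≠ 0`. -/
def boundaries (R : SPre.{u} H) (n : ℕ) (S : NSet.{u}) : Set ((cycles R n).toPreMod.pts S) :=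
  {x | ∃ y : (R.obj (op ⦋n + 1⦌)).pts S, pt_map R (SimplexCategory.δ 0) S y = x.1 ∧
    ∀ i : Fin (n + 2), i ≠ 0 → pt_map R (SimplexCategory.δ i) S y = 0}

/-- `πₙ(R)`: cycles modulo boundaries, the quotient being formed in ind-Banach modules. -/
def homotopyModule (κ : Kind) (R : SPre.{u} H) (n : ℕ) : PreMod.{u} H :=
  (cycles R n).toPreMod.quot ((cycles R n).toPreMod.closedSpan κ (boundaries R n))

/-- The class in `πₙ(R)` of a cycle. -/
def cycleClass (κ : Kind) (R : SPre.{u} H) (n : ℕ) {S : NSet.{u}} :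
    (cycles R n).toPreMod.pts S →+ (homotopyModule κ R n).pts S :=
  QuotientAddGroup.mk' _

/-- The product `s(a) x` of the degeneracy of `a ∈ R₀` with a cycle `x` of degree `n`. -/
def degMul (R : SPre.{u} H) (n : ℕ) {S T : NSet.{u}} (a : (R.obj (op ⦋0⦌)).pts S)
    (x : (cycles R n).toPreMod.pts T) : (cycles R n).toPreMod.pts (S.prod T) :=
  ⟨(R.obj (op ⦋n⦌)).mul (pt_map R (⦋n⦌.const ⦋0⦌ 0) S a) x.1, by
    have hx := x.2
    change _ ∈ ⨅ (m : ℕ) (_ : m < n) (θ : ⦋m⦌ ⟶ ⦋n⦌), (pt_map R θ _).ker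
    change x.1 ∈ ⨅ (m : ℕ) (_ : m < n) (θ : ⦋m⦌ ⟶ ⦋n⦌), (pt_map R θ _).ker at hx
    simp only [AddSubgroup.mem_iInf, AddMonoidHom.mem_ker] at hx ⊢
    intro m hm θ
    have := PreAlg.Hom.app_mul (R.map θ.op) (pt_map R (⦋n⦌.const ⦋0⦌ 0) S a) x.1
    have h2 := hx m hm θ
    simp only [pt_map] at h2 this ⊢
    rw [this, h2, map_zero]⟩

/-- A morphism maps cycles to cycles. -/
def cyclesMap {A B : SPre.{u} H} (f : A ⟶ B) (n : ℕ) {S : NSet.{u}}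
    (x : (cycles A n).toPreMod.pts S) : (cycles B n).toPreMod.pts S :=
  ⟨(PreAlg.Hom.toHom (f.app (op ⦋n⦌))).app S x.1, by
    have hx := x.2
    change _ ∈ ⨅ (m : ℕ) (_ : m < n) (θ : ⦋m⦌ ⟶ ⦋n⦌), (pt_map B θ _).ker
    change x.1 ∈ ⨅ (m : ℕ) (_ : m < n) (θ : ⦋m⦌ ⟶ ⦋n⦌), (pt_map A θ _).ker at hx
    simp only [AddSubgroup.mem_iInf, AddMonoidHom.mem_ker] at hx ⊢
    intro m hm θ
    have h := congrArg (fun g => (PreAlg.Hom.toHom g).app S x.1) (f.naturality θ.op)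
    change (PreAlg.Hom.toHom (f.app _)).app S (pt_map A θ S x.1) = pt_map B θ S _ at h
    rw [← h, hx m hm θ, map_zero]⟩

/-! ## Affinoid morphisms -/

/-- The monoid of exponents `ℕ^d`, all of weight `1`. -/
def expo (d : ℕ) : NSet.{u} := ⟨ULift.{u} (Fin d →₀ ℕ), fun _ => 1⟩

/-- The inclusion of the exponent `0`. -/
def expoZero (d : ℕ) : Map pt.{u} (expo d) := ⟨fun _ => ⟨0⟩, 1, fun _ => by simp [expo, pt]⟩

/-- Addition of exponents. -/
noncomputable def expoAdd (d : ℕ) : Map ((expo.{u} d).prod (expo d)) (expo d) :=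
  ⟨fun x => ⟨x.1.down + x.2.down⟩, 1, fun _ => by simp [expo, NSet.prod]⟩

/-- The set `S × ℕ^d` with the weight `v`. -/
def withExpo (S : NSet.{u}) (d : ℕ) (v : S.carrier × ULift.{u} (Fin d →₀ ℕ) → ℝ≥0) : NSet.{u} :=
  ⟨S.carrier × ULift.{u} (Fin d →₀ ℕ), v⟩

/-- The map `(s, α) ↦ ((s, α), α)`. -/
def withExpoDiag (S : NSet.{u}) (d : ℕ) (v : S.carrier × ULift.{u} (Fin d →₀ ℕ) → ℝ≥0) :
    Map (withExpo S d v) ((withExpo S d v).prod (expo d)) :=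
  ⟨fun x => (x, x.2), 1, fun x => by simp [withExpo, expo, NSet.prod]⟩

/-- The weights that bound the coefficients of an `S`-indexed bounded family of elements of a
Tate algebra `V⟨X₁, …, X_d⟩`: the coefficients are summable, with sum bounded by `C * w s`, or,
in the non-Archimedean case, they tend to zero and their supremum is bounded by `C * w s`. -/
def IsTateWeight (κ : Kind) (S : NSet.{u}) (d : ℕ)
    (v : S.carrier × ULift.{u} (Fin d →₀ ℕ) → ℝ≥0) : Prop :=
  ∃ C : ℝ≥0, match κ.nonarch with
    | false => ∀ s, Summable (fun α => v (s, α)) ∧ ∑' α, v (s, α) ≤ C * S.w s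
    | true => ∀ s, Filter.Tendsto (fun α => v (s, α)) Filter.cofinite (nhds 0) ∧
        ∀ α, v (s, α) ≤ C * S.w s

/-- The `S`-indexed point `y` is the sum over `α` of the `S × ℕ^d`-indexed point `c`, the sum
being formed in one of the Banach modules of a presentation of `M`. -/
def IsSum (κ : Kind) (M : PreMod.{u} H) (S : NSet.{u}) (d : ℕ)
    (v : S.carrier × ULift.{u} (Fin d →₀ ℕ) → ℝ≥0) (c : M.pts (withExpo S d v)) (y : M.pts S) :
    Prop :=
  ∃ (P : IndPresentation κ M) (j : P.J) (f : Bdd (withExpo S d v) (P.obj j).carrier)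
    (g : Bdd S (P.obj j).carrier), P.of j f = c ∧ P.of j g = y ∧
      ∀ s, HasSum (fun α => f.1 (s, α)) (g.1 s)

/-- The morphism `A ⟶ B` extends to a strict surjection `A⟨X₁, …, X_d⟩ ⟶ B` for some `d`.
The extensions to `A⟨X₁, …, X_d⟩` correspond to the bounded multiplicative families
`b = (b ^ α)_α` of monomials in the images of the `X_i`, by `∑ a_α X ^ α ↦ ∑ φ(a_α) b ^ α`, and
strict surjectivity means that every point of `B` lifts. -/
def TateSurjective (κ : Kind) {A B : PreAlg.{u} H} (φ : A ⟶ B) : Prop :=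
  ∃ (d : ℕ) (b : B.pts (expo d)),
    B.pull (expoZero d) b = B.one ∧ B.pull (expoAdd d) b = B.mul b b ∧
    ∀ (S : NSet.{u}) (y : B.pts S), ∃ (v : S.carrier × ULift.{u} (Fin d →₀ ℕ) → ℝ≥0)
      (a : A.pts (withExpo S d v)), IsTateWeight κ S d v ∧
        IsSum κ B.toPreMod S d v
          (B.pull (withExpoDiag S d v) (B.mul ((PreAlg.Hom.toHom φ).app _ a) b)) y

/-- Bounded `H`-bilinear and `π₀(A)`-balanced maps `π₀(B) × πₙ(A) → N`. -/
structure BalancedMap (κ : Kind) {A B : SPre.{u} H} (f : A ⟶ B) (n : ℕ) (N : PreMod.{u} H) where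
  toFun : ∀ {S T : NSet.{u}}, (piZero κ B).pts S →+ (homotopyModule κ A n).pts T →+
    N.pts (S.prod T)
  pull : ∀ {S T S' T' : NSet.{u}} (p : Map S' S) (q : Map T' T) (b : (piZero κ B).pts S)
    (x : (homotopyModule κ A n).pts T),
    toFun ((piZero κ B).pull p b) ((homotopyModule κ A n).pull q x) =
      N.pull (p.prodMap q) (toFun b x)
  act : ∀ {U S T : NSet.{u}} (c : Bdd U H) (b : (piZero κ B).pts S)
    (x : (homotopyModule κ A n).pts T),
    toFun ((piZero κ B).act c b) x = N.pull (Map.assoc U S T) (N.act c (toFun b x))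
  balanced : ∀ {S U T : NSet.{u}} (b : (piZero κ B).pts S) (a : (A.obj (op ⦋0⦌)).pts U)
    (x : (cycles A n).toPreMod.pts T),
    toFun ((piZero κ B).mul b
      ((PreAlg.Hom.toHom (f.app (op ⦋0⦌) ≫ piZeroProj κ B)).app U a)) (cycleClass κ A n x) =
      N.pull (Map.assoc S U T) (toFun b (cycleClass κ A n (degMul A n a x)))

/-- The multiplication map `π₀(B) ⊗_{π₀(A)} πₙ(A) ⟶ πₙ(B)` is an isomorphism of ind-Banach
modules: `πₙ(B)`, with `(b, x) ↦ b f(x)`, has the universal property of the completed tensor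
product. -/
def TensorIso (κ : Kind) {A B : SPre.{u} H} (f : A ⟶ B) (n : ℕ) : Prop :=
  ∀ N : PreMod.{u} H, IsInd κ N → ∀ β : BalancedMap κ f n N,
    ∃! g : PreMod.Hom (homotopyModule κ B n) N,
      ∀ {S T : NSet.{u}} (b : (B.obj (op ⦋0⦌)).pts S) (x : (cycles A n).toPreMod.pts T),
        g.app _ (cycleClass κ B n (degMul B n b (cyclesMap f n x))) =
          β.toFun ((PreAlg.Hom.toHom (piZeroProj κ B)).app S b) (cycleClass κ A n x)

/-- Affinoid morphisms: `π₀(B)` is a quotient of some `π₀(A)⟨X₁, …, X_d⟩`, and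
`π₀(B) ⊗_{π₀(A)} πₙ(A) ≅ πₙ(B)` for all `n`. (Surjectivity is tested on `A₀⟨X₁, …, X_d⟩`, which
maps by a strict surjection onto `π₀(A)⟨X₁, …, X_d⟩`.) -/
def IsAffinoid (κ : Kind) {A B : SPre.{u} H} (f : A ⟶ B) : Prop :=
  TateSurjective κ (f.app (op ⦋0⦌) ≫ piZeroProj κ B) ∧ ∀ n, TensorIso κ f n

/-! ## Mapping spaces -/

/-- Trivial fibrations: on points over every normed set (that is, on maps from projective
modules) they are trivial Kan fibrations. -/
def IsTrivFib {E F : SPre.{u} H} (p : E ⟶ F) : Prop :=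
  ∀ S : NSet.{u}, SSet.modelCategoryQuillen.I.{u}.rlp
    (Functor.whiskerRight p (PreAlg.evalFunctor S))

/-- Cofibrant objects: the morphism from the initial object has the left lifting property against
the trivial fibrations of simplicial commutative ind-Banach algebras. -/
def IsCofibrant (κ : Kind) (Q : SPre.{u} H) : Prop :=
  ∀ ⦃E F : SPre.{u} H⦄, IsSimpInd κ E → IsSimpInd κ F → ∀ p : E ⟶ F, IsTrivFib p →
    ∀ g : Q ⟶ F, ∃ g' : Q ⟶ E, g' ≫ p = g

/-- A cofibrant model of a morphism `f : A ⟶ B`: cofibrant replacements of `A` and `B` and a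
morphism between them over `f`. -/
structure CofibrantModel (κ : Kind) {A B : SPre.{u} H} (f : A ⟶ B) where
  QA : SPre.{u} H
  QB : SPre.{u} H
  indA : IsSimpInd κ QA
  indB : IsSimpInd κ QB
  cofA : IsCofibrant κ QA
  cofB : IsCofibrant κ QB
  pA : QA ⟶ A
  pB : QB ⟶ B
  trivA : IsTrivFib pA
  trivB : IsTrivFib pB
  Qf : QA ⟶ QB
  comm : Qf ≫ pB = pA ≫ f

/-- The function complex of simplicial objects. If `Q` is a cofibrant replacement of `B` then
`mapSpace Q R` is the mapping space `X(R)` for `X = Spec B` (all objects are fibrant). -/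
abbrev mapSpace (Q R : SPre.{u} H) : SSet.{u + 1} := SimplicialCategory.sHom Q R

/-- Functoriality of the function complex in the target. -/
def mapSpace.post (Q : SPre.{u} H) {R R' : SPre.{u} H} (g : R ⟶ R') :
    mapSpace Q R ⟶ mapSpace Q R' where
  app _ := ↾fun x => Functor.HomObj.comp x (Functor.HomObj.ofNatTrans g)

/-- Functoriality of the function complex in the source. -/
def mapSpace.pre {Q Q' : SPre.{u} H} (h : Q ⟶ Q') (R : SPre.{u} H) :
    mapSpace Q' R ⟶ mapSpace Q R where
  app _ := ↾fun x => Functor.HomObj.comp (Functor.HomObj.ofNatTrans h) x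

theorem mapSpace.post_comp (Q : SPre.{u} H) {R R' R'' : SPre.{u} H} (g : R ⟶ R') (g' : R' ⟶ R'') :
    mapSpace.post Q g ≫ mapSpace.post Q g' = mapSpace.post Q (g ≫ g') := by
  ext n x
  apply Functor.HomObj.ext
  funext c a
  exact Category.assoc _ _ _

theorem mapSpace.post_id (Q R : SPre.{u} H) : mapSpace.post Q (𝟙 R) = 𝟙 _ := by
  ext n x
  apply Functor.HomObj.ext
  funext c a
  exact Category.comp_id _

theorem mapSpace.pre_post {Q Q' : SPre.{u} H} (h : Q ⟶ Q') {R R' : SPre.{u} H} (g : R ⟶ R') :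
    mapSpace.pre h R ≫ mapSpace.post Q g = mapSpace.post Q' g ≫ mapSpace.pre h R' := by
  ext n x
  apply Functor.HomObj.ext
  funext c a
  exact Category.assoc _ _ _

/-! ## Homotopy pullbacks and homotopy colimits of simplicial sets -/

universe v w

theorem yonedaEquiv_symm_map {Z : SSet.{v}} {n m : SimplexCategoryᵒᵖ} (θ : n ⟶ m) (z : Z.obj n) :
    SSet.stdSimplex.map θ.unop ≫ SSet.yonedaEquiv.symm z =
      SSet.yonedaEquiv.symm (Z.map θ z) := 
  SSet.yonedaEquiv_symm_naturality_left _ _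

/-- The simplices `(x, h, y)` of the homotopy pullback: `h` is a path in `Z` from the image of
`x` to the image of `y`. -/
def hoPullbackSet {X Y Z : SSet.{v}} (f : X ⟶ Z) (g : Y ⟶ Z) (n : SimplexCategoryᵒᵖ) : Type v :=
  {t : X.obj n × ((SSet.stdSimplex.obj n.unop ⊗ Δ[1] : SSet.{v}) ⟶ Z) × Y.obj n //
    SSet.ι₀ ≫ t.2.1 = SSet.yonedaEquiv.symm (f.app n t.1) ∧
    SSet.ι₁ ≫ t.2.1 = SSet.yonedaEquiv.symm (g.app n t.2.2)}

/-- The homotopy pullback `X ×_Z Z^Δ[1] ×_Z Y` (for `Z` a Kan complex). -/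
def hoPullback {X Y Z : SSet.{v}} (f : X ⟶ Z) (g : Y ⟶ Z) : SSet.{v} where
  obj n := hoPullbackSet f g n
  map {n m} θ := ↾fun t => ⟨(X.map θ t.1.1,
      (SSet.stdSimplex.map θ.unop ▷ Δ[1]) ≫ t.1.2.1, Y.map θ t.1.2.2), by
    refine ⟨?_, ?_⟩
    · change SSet.ι₀ ≫ (SSet.stdSimplex.map θ.unop ▷ Δ[1]) ≫ t.1.2.1 = _
      rw [SSet.ι₀_comp_assoc, t.2.1, yonedaEquiv_symm_map]
      exact congrArg _ (NatTrans.naturality_apply f θ t.1.1).symm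
    · change SSet.ι₁ ≫ (SSet.stdSimplex.map θ.unop ▷ Δ[1]) ≫ t.1.2.1 = _
      rw [SSet.ι₁_comp_assoc, t.2.2, yonedaEquiv_symm_map]
      exact congrArg _ (NatTrans.naturality_apply g θ t.1.2.2).symm⟩
  map_id n := by
    ext t
    apply Subtype.ext
    refine Prod.ext ?_ (Prod.ext ?_ ?_)
    · change X.map (𝟙 n) t.1.1 = t.1.1
      simp
    · change (SSet.stdSimplex.map (𝟙 n.unop) ▷ Δ[1]) ≫ t.1.2.1 = t.1.2.1
      have h := congrArg (fun k => k ▷ Δ[1] ≫ t.1.2.1) (SSet.stdSimplex.{v}.map_id n.unop)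
      exact h.trans (by rw [MonoidalCategory.id_whiskerRight, Category.id_comp])
    · change Y.map (𝟙 n) t.1.2.2 = t.1.2.2
      simp
  map_comp θ η := by
    ext t
    apply Subtype.ext
    refine Prod.ext ?_ (Prod.ext ?_ ?_)
    · change X.map (θ ≫ η) t.1.1 = X.map η (X.map θ t.1.1)
      simp
    · change (SSet.stdSimplex.map (η.unop ≫ θ.unop) ▷ Δ[1]) ≫ t.1.2.1 =
        (SSet.stdSimplex.map η.unop ▷ Δ[1]) ≫ (SSet.stdSimplex.map θ.unop ▷ Δ[1]) ≫ t.1.2.1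
      have h := congrArg (fun k => k ▷ Δ[1] ≫ t.1.2.1)
        (SSet.stdSimplex.{v}.map_comp η.unop θ.unop)
      exact h.trans (by rw [MonoidalCategory.comp_whiskerRight, Category.assoc])
    · change Y.map (θ ≫ η) t.1.2.2 = Y.map η (Y.map θ t.1.2.2)
      simp

/-- Functoriality of the homotopy pullback in `X` and `Z`. -/
def hoPullback.map {X Y Z X' Z' : SSet.{v}} {f : X ⟶ Z} {g : Y ⟶ Z} {f' : X' ⟶ Z'}
    {g' : Y ⟶ Z'} (a : X ⟶ X') (c : Z ⟶ Z') (hf : f ≫ c = a ≫ f') (hg : g ≫ c = g') :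
    hoPullback f g ⟶ hoPullback f' g' where
  app n := ↾fun t => ⟨(a.app n t.1.1, t.1.2.1 ≫ c, t.1.2.2), by
    refine ⟨?_, ?_⟩
    · change SSet.ι₀ ≫ t.1.2.1 ≫ c = SSet.yonedaEquiv.symm ((a ≫ f').app n t.1.1)
      rw [← Category.assoc, t.2.1, ← hf, SSet.yonedaEquiv_symm_comp]
      rfl
    · change SSet.ι₁ ≫ t.1.2.1 ≫ c = SSet.yonedaEquiv.symm (g'.app n t.1.2.2)
      rw [← Category.assoc, t.2.2, ← hg, SSet.yonedaEquiv_symm_comp]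
      rfl⟩
  naturality n m θ := by
    ext t
    apply Subtype.ext
    refine Prod.ext ?_ (Prod.ext ?_ ?_)
    · exact NatTrans.naturality_apply a θ t.1.1
    · exact Category.assoc _ _ _
    · rfl

/-- The point `(x, constant path, y)` of the homotopy pullback given by `x` and `y` with the same
image in `Z`. -/
def hoPullback.lift {W X Y Z : SSet.{v}} {f : X ⟶ Z} {g : Y ⟶ Z} (a : W ⟶ X) (b : W ⟶ Y)
    (h : a ≫ f = b ≫ g) : W ⟶ hoPullback f g where
  app n := ↾fun t => ⟨(a.app n t, CartesianMonoidalCategory.fst _ _ ≫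
      SSet.yonedaEquiv.symm ((a ≫ f).app n t), b.app n t), by
    refine ⟨?_, ?_⟩
    · change SSet.ι₀ ≫ CartesianMonoidalCategory.fst _ _ ≫ _ = _
      rw [← Category.assoc, SSet.ι₀_fst, Category.id_comp]
      rfl
    · change SSet.ι₁ ≫ CartesianMonoidalCategory.fst _ _ ≫ _ = _
      rw [← Category.assoc, SSet.ι₁_fst, Category.id_comp, h]
      rfl⟩
  naturality n m θ := by
    ext t
    apply Subtype.ext
    refine Prod.ext ?_ (Prod.ext ?_ ?_)
    · exact NatTrans.naturality_apply a θ t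
    · change CartesianMonoidalCategory.fst _ _ ≫ SSet.yonedaEquiv.symm ((a ≫ f).app m (W.map θ t)) =
        (SSet.stdSimplex.map θ.unop ▷ Δ[1]) ≫ CartesianMonoidalCategory.fst _ _ ≫
          SSet.yonedaEquiv.symm ((a ≫ f).app n t)
      rw [NatTrans.naturality_apply, ← yonedaEquiv_symm_map,
        CartesianMonoidalCategory.whiskerRight_fst_assoc]
    · exact NatTrans.naturality_apply b θ t

theorem hoPullback.map_id {X Y Z : SSet.{v}} {f : X ⟶ Z} {g : Y ⟶ Z} (a : X ⟶ X) (c : Z ⟶ Z)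
    (hf : f ≫ c = a ≫ f) (hg : g ≫ c = g) (ha : a = 𝟙 X) (hc : c = 𝟙 Z) :
    hoPullback.map a c hf hg = 𝟙 (hoPullback f g) := by
  subst ha hc
  ext n t
  apply Subtype.ext
  refine Prod.ext rfl (Prod.ext ?_ rfl)
  exact Category.comp_id _

theorem hoPullback.map_comp {X Y Z X' Z' X'' Z'' : SSet.{v}} {f : X ⟶ Z} {g : Y ⟶ Z}
    {f' : X' ⟶ Z'} {g' : Y ⟶ Z'} {f'' : X'' ⟶ Z''} {g'' : Y ⟶ Z''} (a : X ⟶ X') (c : Z ⟶ Z')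
    (a' : X' ⟶ X'') (c' : Z' ⟶ Z'') (a'' : X ⟶ X'') (c'' : Z ⟶ Z'')
    (hf : f ≫ c = a ≫ f') (hg : g ≫ c = g') (hf' : f' ≫ c' = a' ≫ f'') (hg' : g' ≫ c' = g'')
    (hf'' : f ≫ c'' = a'' ≫ f'') (hg'' : g ≫ c'' = g'') (ha : a'' = a ≫ a')
    (hc : c'' = c ≫ c') :
    hoPullback.map a'' c'' hf'' hg'' = hoPullback.map a c hf hg ≫ hoPullback.map a' c' hf' hg' := by
  subst ha hc
  ext n t
  apply Subtype.ext
  refine Prod.ext rfl (Prod.ext ?_ rfl)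
  exact (Category.assoc _ _ _).symm

theorem hoColim_ext {P : Type w} [Preorder P] (F : P ⥤ SSet.{max v w}) {n : SimplexCategoryᵒᵖ}
    {x y : Σ c : Fin (n.unop.len + 1) →o P, (F.obj (c 0)).obj n} (h : x.1 = y.1)
    (h' : (F.map (homOfLE (by rw [h]))).app n x.2 = y.2) : x = y := by
  obtain ⟨c, x⟩ := x
  obtain ⟨d, y⟩ := y
  obtain rfl : c = d := h
  have : (F.map (homOfLE (le_refl (c 0)))).app n x = x := by
    change (F.map (𝟙 _)).app n x = x
    simp
  exact congrArg (Sigma.mk c) (this.symm.trans h')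

theorem hoColim_comp {P : Type w} [Preorder P] (F : P ⥤ SSet.{max v w}) {p q r : P} (h : p ⟶ q)
    (h' : q ⟶ r) (h'' : p ⟶ r) (e : r ⟶ r) {n m k : SimplexCategoryᵒᵖ} (θ : n ⟶ m) (η : m ⟶ k)
    (x : (F.obj p).obj n) :
    (F.map e).app k ((F.obj r).map (θ ≫ η) ((F.map h'').app n x)) =
      (F.obj r).map η ((F.map h').app m ((F.obj q).map θ ((F.map h).app n x))) := by
  obtain rfl : e = 𝟙 r := Subsingleton.elim _ _
  obtain rfl : h'' = h ≫ h' := Subsingleton.elim _ _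
  rw [NatTrans.naturality_apply]
  simp

/-- The homotopy colimit of a diagram indexed by a preorder, as the simplicial set whose
`n`-simplices are the chains `p₀ ≤ ⋯ ≤ p_n` with an `n`-simplex of `F(p₀)`. -/
def hoColim {P : Type w} [Preorder P] (F : P ⥤ SSet.{max v w}) : SSet.{max v w} where
  obj n := Σ c : Fin (n.unop.len + 1) →o P, (F.obj (c 0)).obj n
  map {n m} θ := ↾fun x => ⟨x.1.comp θ.unop.toOrderHom,
    (F.obj _).map θ ((F.map (homOfLE (x.1.monotone (Fin.zero_le _)))).app n x.2)⟩
  map_id n := by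
    refine ConcreteCategory.hom_ext _ _ (fun x => ?_)
    apply hoColim_ext F
    case h => rfl
    change (F.map (𝟙 _)).app n ((F.obj _).map (𝟙 n) ((F.map (𝟙 _)).app n x.2)) = x.2
    simp
  map_comp {n m k} θ η := by
    refine ConcreteCategory.hom_ext _ _ (fun x => ?_)
    apply hoColim_ext F
    case h => rfl
    exact hoColim_comp F _ _ _ _ θ η x.2

/-- The inclusion of `F(p)` into the homotopy colimit. -/
def hoColim.ι {P : Type w} [Preorder P] (F : P ⥤ SSet.{max v w}) (p : P) :
    F.obj p ⟶ hoColim F where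
  app n := ↾fun x => ⟨OrderHom.const _ p, x⟩
  naturality n m θ := by
    refine ConcreteCategory.hom_ext _ _ (fun x => ?_)
    apply hoColim_ext F
    case h => rfl
    change (F.map (𝟙 _)).app m ((F.obj p).map θ x) = (F.obj _).map θ ((F.map (𝟙 _)).app n x)
    simp

/-! ## Formal completions -/

theorem vertex_piZeroProj_aux (κ : Kind) (R : SPre.{u} H) (n : SimplexCategory)
    {i j : Fin (n.len + 1)} (h : i ≤ j) :
    R.map (⦋0⦌.const n i).op ≫ piZeroProj κ R = R.map (⦋0⦌.const n j).op ≫ piZeroProj κ R := by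
  obtain ⟨n⟩ := n
  apply PreAlg.Hom.ext
  funext S
  ext x
  change QuotientAddGroup.mk (s := (zeroIdeal κ R).carrier S) (pt_map R (⦋0⦌.const ⦋n⦌ i) S x) =
    QuotientAddGroup.mk (s := (zeroIdeal κ R).carrier S) (pt_map R (⦋0⦌.const ⦋n⦌ j) S x)
  rw [QuotientAddGroup.eq]
  change _ ∈ ⨅ K : {K : (R.obj (op ⦋0⦌)).Idl // K.IsClosed κ ∧
    ∀ S, zeroBoundaries R S ⊆ K.carrier S}, K.1.carrier S
  rw [AddSubgroup.mem_iInf]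
  intro K
  refine K.2.2 S ⟨pt_map R (SimplexCategory.mkOfLe i j h) S x, ?_⟩
  have h0 : SimplexCategory.δ (n := 0) 0 ≫ SimplexCategory.mkOfLe i j h = ⦋0⦌.const ⦋n⦌ j := by
    ext k
    fin_cases k
    rfl
  have h1 : SimplexCategory.δ (n := 0) 1 ≫ SimplexCategory.mkOfLe i j h = ⦋0⦌.const ⦋n⦌ i := by
    ext k
    fin_cases k
    rfl
  rw [← h0, ← h1, pt_map_comp, pt_map_comp]
  abel

theorem vertex_piZeroProj (κ : Kind) (R : SPre.{u} H) (n : SimplexCategory)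
    (i j : Fin (n.len + 1)) :
    R.map (⦋0⦌.const n i).op ≫ piZeroProj κ R = R.map (⦋0⦌.const n j).op ≫ piZeroProj κ R := by
  rcases le_total i j with h | h
  · exact vertex_piZeroProj_aux κ R n h
  · exact (vertex_piZeroProj_aux κ R n h).symm

/-- The discrete simplicial algebra `π₀(R)/I`. -/
abbrev discreteQuot (κ : Kind) (R : SPre.{u} H) (I : Ideal (piZero κ R).Ring) : SPre.{u} H :=
  (SimplicialObject.const (PreAlg.{u} H)).obj (((piZero κ R).modIdealFunctor κ).obj I)

/-- The projection `π₀(R)/I ⟶ π₀(R)/J` for `I ≤ J`. -/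
abbrev discreteQuotMap (κ : Kind) (R : SPre.{u} H) {I J : Ideal (piZero κ R).Ring} (h : I ⟶ J) :
    discreteQuot κ R I ⟶ discreteQuot κ R J :=
  (SimplicialObject.const (PreAlg.{u} H)).map (((piZero κ R).modIdealFunctor κ).map h)

/-- The morphism from `R` to a discrete simplicial algebra given by a morphism out of `π₀(R)`. -/
def toDiscrete (κ : Kind) (R : SPre.{u} H) {C : PreAlg.{u} H} (g : piZero κ R ⟶ C) :
    R ⟶ (SimplicialObject.const (PreAlg.{u} H)).obj C where
  app n := (R.map (⦋0⦌.const n.unop 0).op ≫ piZeroProj κ R) ≫ g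
  naturality n m θ := by
    have h1 := vertex_piZeroProj κ R n.unop ((θ.unop.toOrderHom 0)) 0
    have h2 : R.map (⦋0⦌.const n.unop (θ.unop.toOrderHom 0)).op =
        R.map θ ≫ R.map (⦋0⦌.const m.unop 0).op := by
      rw [← R.map_comp]
      rfl
    rw [h2, Category.assoc] at h1
    refine (Category.assoc _ _ _).symm.trans (Eq.trans ?_ (Category.comp_id _).symm)
    exact congrArg (· ≫ g) h1

theorem toDiscrete_map (κ : Kind) (R : SPre.{u} H) {C D : PreAlg.{u} H} (g : piZero κ R ⟶ C)
    (h : C ⟶ D) : toDiscrete κ R g ≫ (SimplicialObject.const (PreAlg.{u} H)).map h =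
      toDiscrete κ R (g ≫ h) := by
  apply NatTrans.ext
  funext n
  exact Category.assoc _ _ _

/-- The projection `R ⟶ π₀(R)/I`. -/
def toDiscreteQuot (κ : Kind) (R : SPre.{u} H) (I : Ideal (piZero κ R).Ring) :
    R ⟶ discreteQuot κ R I :=
  toDiscrete κ R ((piZero κ R).proj ((piZero κ R).closedIdeal κ I))

theorem toDiscreteQuot_map (κ : Kind) (R : SPre.{u} H) {I J : Ideal (piZero κ R).Ring}
    (h : I ⟶ J) : toDiscreteQuot κ R I ≫ discreteQuotMap κ R h = toDiscreteQuot κ R J :=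
  (toDiscrete_map κ R _ _).trans (congrArg (toDiscrete κ R) (PreAlg.proj_quotMap _ _ _ _))

theorem discreteQuotMap_id (κ : Kind) (R : SPre.{u} H) {I : Ideal (piZero κ R).Ring}
    (h : I ⟶ I) : discreteQuotMap κ R h = 𝟙 _ := by
  obtain rfl : h = 𝟙 I := Subsingleton.elim _ _
  rw [discreteQuotMap, CategoryTheory.Functor.map_id, CategoryTheory.Functor.map_id]

theorem discreteQuotMap_comp (κ : Kind) (R : SPre.{u} H) {I J K : Ideal (piZero κ R).Ring}
    (h : I ⟶ J) (h' : J ⟶ K) (h'' : I ⟶ K) :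
    discreteQuotMap κ R h'' = discreteQuotMap κ R h ≫ discreteQuotMap κ R h' := by
  obtain rfl : h'' = h ≫ h' := Subsingleton.elim _ _
  rw [discreteQuotMap, CategoryTheory.Functor.map_comp, CategoryTheory.Functor.map_comp]

variable {κ : Kind} {A B : SPre.{u} H} {f : A ⟶ B}

/-- For `X = Spec B`, `Y = Spec A` and a family of ideals `I_p` of `π₀(R)` indexed by a preorder
`P`, the diagram `p ↦ X(π₀(R)/I_p) ×_{Y(π₀(R)/I_p)} Y(R)` of homotopy pullbacks. -/
def completionDiagram (Q : CofibrantModel κ f) (R : SPre.{u} H) {P : Type u} [Preorder P]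
    (ι : P →o Ideal (piZero κ R).Ring) : P ⥤ SSet.{u + 1} where
  obj p := hoPullback (mapSpace.pre Q.Qf (discreteQuot κ R (ι p)))
    (mapSpace.post Q.QA (toDiscreteQuot κ R (ι p)))
  map h := hoPullback.map
    (mapSpace.post Q.QB (discreteQuotMap κ R (homOfLE (ι.monotone (leOfHom h)))))
    (mapSpace.post Q.QA (discreteQuotMap κ R (homOfLE (ι.monotone (leOfHom h)))))
    (mapSpace.pre_post _ _)
    ((mapSpace.post_comp _ _ _).trans (congrArg _ (toDiscreteQuot_map κ R _)))
  map_id _ := hoPullback.map_id _ _ _ _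
    ((congrArg _ (discreteQuotMap_id κ R _)).trans (mapSpace.post_id _ _))
    ((congrArg _ (discreteQuotMap_id κ R _)).trans (mapSpace.post_id _ _))
  map_comp _ _ := hoPullback.map_comp _ _ _ _ _ _ _ _ _ _ _ _
    ((congrArg _ (discreteQuotMap_comp κ R _ _ _)).trans (mapSpace.post_comp _ _ _).symm)
    ((congrArg _ (discreteQuotMap_comp κ R _ _ _)).trans (mapSpace.post_comp _ _ _).symm)

/-- The homotopy colimit over `p` of `X(π₀(R)/I_p) ×_{Y(π₀(R)/I_p)} Y(R)`. -/
def completion (Q : CofibrantModel κ f) (R : SPre.{u} H) {P : Type u} [Preorder P]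
    (ι : P →o Ideal (piZero κ R).Ring) : SSet.{u + 1} :=
  hoColim.{u + 1, u} (completionDiagram Q R ι)

/-- The canonical map from `X(R)` to the completion, through the term of the index `p`. -/
def toCompletion (Q : CofibrantModel κ f) (R : SPre.{u} H) {P : Type u} [Preorder P]
    (ι : P →o Ideal (piZero κ R).Ring) (p : P) : mapSpace Q.QB R ⟶ completion Q R ι :=
  hoPullback.lift (mapSpace.post Q.QB (toDiscreteQuot κ R (ι p))) (mapSpace.pre Q.Qf R)
      (mapSpace.pre_post _ _).symm ≫
    hoColim.ι.{u + 1, u} (completionDiagram Q R ι) p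

/-- The poset of nilpotent ideals of a ring. -/
abbrev NilIdeal (A : Type u) [CommRing A] : Type u := {I : Ideal A // IsNilpotent I}

/-- Nilpotent ideals of a ring together with a divided power structure. -/
structure PDNilIdeal (A : Type u) [CommRing A] : Type u where
  ideal : Ideal A
  nilpotent : IsNilpotent ideal
  pd : DividedPowers ideal

/-- `(I, γ) ≤ (J, δ)` if `I ≤ J` and `δ` extends `γ`. -/
instance (A : Type u) [CommRing A] : Preorder (PDNilIdeal A) where
  le I J := I.ideal ≤ J.ideal ∧ ∀ (n : ℕ), ∀ a ∈ I.ideal, J.pd.dpow n a = I.pd.dpow n a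
  le_refl I := ⟨le_rfl, fun _ _ _ => rfl⟩
  le_trans I J K h h' :=
    ⟨h.1.trans h'.1, fun n a ha => (h'.2 n a (h.1 ha)).trans (h.2 n a ha)⟩

/-- The zero ideal. -/
def NilIdeal.zero (A : Type u) [CommRing A] : NilIdeal A := ⟨⊥, 1, by simp⟩

/-- The zero ideal with its divided powers. -/
noncomputable def PDNilIdeal.zero (A : Type u) [CommRing A] : PDNilIdeal A :=
  ⟨⊥, ⟨1, by simp⟩, dividedPowersBot A⟩

def NilIdeal.toIdeal (A : Type u) [CommRing A] : NilIdeal A →o Ideal A :=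
  ⟨fun I => I.1, fun _ _ h => h⟩

def PDNilIdeal.toIdeal (A : Type u) [CommRing A] : PDNilIdeal A →o Ideal A :=
  ⟨fun I => I.ideal, fun _ _ h => h.1⟩

/-- The formal completion `Y_{X,dR}(R) = colim_I X(π₀(R)/I) ×_{Y(π₀(R)/I)} Y(R)`, over all
nilpotent ideals `I` of `π₀(R)`. -/
def deRhamCompletion (Q : CofibrantModel κ f) (R : SPre.{u} H) : SSet.{u + 1} :=
  completion Q R (NilIdeal.toIdeal (piZero κ R).Ring)

/-- The PD completion `Y_{X,crys}(R) = colim_{(I,γ)} X(π₀(R)/I) ×_{Y(π₀(R)/I)} Y(R)`, over all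
nilpotent ideals `I` of `π₀(R)` and all divided power structures `γ` on `I`. -/
def crysCompletion (Q : CofibrantModel κ f) (R : SPre.{u} H) : SSet.{u + 1} :=
  completion Q R (PDNilIdeal.toIdeal (piZero κ R).Ring)

/-- The canonical map `X(R) ⟶ Y_{X,dR}(R)`. -/
def toDeRhamCompletion (Q : CofibrantModel κ f) (R : SPre.{u} H) :
    mapSpace Q.QB R ⟶ deRhamCompletion Q R :=
  toCompletion Q R _ (NilIdeal.zero _)

/-- The canonical map `X(R) ⟶ Y_{X,crys}(R)`. -/
noncomputable def toCrysCompletion (Q : CofibrantModel κ f) (R : SPre.{u} H) :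
    mapSpace Q.QB R ⟶ crysCompletion Q R :=
  toCompletion Q R _ (PDNilIdeal.zero _)

/-- De Rham intrinsic étale morphisms `Spec B → Spec A`: affinoid, and
`π₀(X(R)) → π₀(Y_{X,dR}(R))` is bijective for every simplicial commutative ind-Banach algebra
`R`. The mapping spaces are computed with the cofibrant model `Q` of `f`; up to equivalence they
do not depend on it. -/
def IsDeRhamIntrinsicEtale (κ : Kind) {A B : SPre.{u} H} (f : A ⟶ B) (Q : CofibrantModel κ f) :
    Prop :=
  IsAffinoid κ f ∧ ∀ R : SPre.{u} H, IsSimpInd κ R →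
    Function.Bijective (SSet.mapπ₀ (toDeRhamCompletion Q R))

/-- PD intrinsic étale morphisms `Spec B → Spec A`: affinoid, and
`π₀(X(R)) → π₀(Y_{X,crys}(R))` is bijective for every simplicial commutative ind-Banach algebra
`R`. -/
def IsPDIntrinsicEtale (κ : Kind) {A B : SPre.{u} H} (f : A ⟶ B) (Q : CofibrantModel κ f) :
    Prop :=
  IsAffinoid κ f ∧ ∀ R : SPre.{u} H, IsSimpInd κ R →
    Function.Bijective (SSet.mapπ₀ (toCrysCompletion Q R))

end IndBanach

namespace IndBanach

universe v w

variable {H : Type u} [NormedCommRing H]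

/-! ## Discrete simplicial sets -/

/-! Both notions demand the same affinoid condition, so only the two bijections on components
matter. Each PD ideal is in particular a nilpotent ideal, and the terms of the two diagrams agree,
so on components the map from `X(R)` to the de Rham completion factors through the PD completion
(`crysToDeRham`). Injectivity for the former therefore gives injectivity for the latter.

For surjectivity, represent a component of the PD completion by a point `t` of `X(π₀(R)/I)
×_{Y(π₀(R)/I)} Y(R)`. De Rham surjectivity gives a point `x` of `X(R)` with the same class in the de
Rham completion. Nilpotent ideals are directed, so `x` and `t` agree on components at some nilpotent
`J ⊇ I` (`hoColim.exists_of_class_eq`). The divided powers of `I` need not extend to `J`, so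
agreement has to be brought back from `J` to `I`. This is done by the de Rham condition for a second
test algebra, the discrete algebra `π₀(R)/I`: injectivity there says that a point of `X(π₀(R)/I)` is
determined by its images in `X(π₀(R)/J)` and `Y(π₀(R)/I)` (`eq_of_post_eq_of_pre_eq`). Hence `x` and
`t` agree at `I` itself (`mk_completionPoint_eq`), with whatever divided powers `I` carries. No
directedness of PD ideals is needed.

Two supporting facts make this precise. Mapping spaces into discrete algebras are discrete
(`isDiscrete_mapSpace_const`), so a point of the homotopy pullback is a pair of points with equal
images, and its component depends only on the first coordinate and the component of the second. And
`π₀(R)/I` must be an ind-Banach algebra to serve as a test object. This amounts to stability of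
closed subobjects under intersection, proved by describing them through closed submodules of the
terms of a presentation (`IndPresentation.Saturated`). -/

theorem map_vertex_map_const (X : SSet.{v}) {n : SimplexCategory} (θ : ⦋0⦌ ⟶ n) (x : X _⦋0⦌) :
    X.map θ.op (X.map (n.const ⦋0⦌ 0).op x) = x := by
  rw [← Functor.map_comp_apply]
  have : (n.const ⦋0⦌ 0).op ≫ θ.op = 𝟙 (op ⦋0⦌) :=
    Quiver.Hom.unop_inj (Subsingleton.elim _ _)
  rw [this]
  simp

theorem map_endo_app {P : Type w} [Preorder P] (F : P ⥤ SSet.{v}) {p : P} (e : p ⟶ p)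
    {n : SimplexCategoryᵒᵖ} (x : (F.obj p).obj n) : (F.map e).app n x = x := by
  obtain rfl : e = 𝟙 p := Subsingleton.elim _ _
  simp

/-- All operators between two given degrees act in the same way. -/
def IsDiscrete (Z : SSet.{v}) : Prop :=
  ∀ ⦃m n : SimplexCategory⦄ (θ θ' : m ⟶ n) (z : Z.obj (op n)), Z.map θ.op z = Z.map θ'.op z

namespace IsDiscrete

variable {X Y Z W : SSet.{v}}

theorem eq_of_edge (hZ : IsDiscrete Z) {x y : Z _⦋0⦌} (e : Z.Edge x y) : x = y := by
  exact e.src_eq.symm.trans ((hZ _ _ _).trans e.tgt_eq)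

theorem eq_of_mk_eq (hZ : IsDiscrete Z) {x y : Z _⦋0⦌} (h : SSet.π₀.mk x = SSet.π₀.mk y) :
    x = y :=
  congrArg (SSet.π₀.lift id fun _ _ e => hZ.eq_of_edge e) h

/-- In a discrete simplicial set the composite of a vertex with the degeneracy back acts as the
identity does, so restriction to any vertex has a left inverse. Equalities of simplices can thus be
tested on one vertex. -/
theorem map_vertex_injective (hZ : IsDiscrete Z) {n : SimplexCategory} (v : ⦋0⦌ ⟶ n) :
    Function.Injective (Z.map v.op) := by
  intro x y h
  have key : ∀ z : Z.obj (op n), z = Z.map (n.const ⦋0⦌ 0).op (Z.map v.op z) := by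
    intro z
    have h1 := hZ (𝟙 n) (n.const ⦋0⦌ 0 ≫ v) z
    rw [op_comp, Functor.map_comp_apply] at h1
    simpa only [op_id, Functor.map_id_apply] using h1
  rw [key x, key y, h]

/-- Homotopies into a discrete simplicial set are determined by their source. -/
theorem homotopy_ext (hZ : IsDiscrete Z) {h h' : W ⊗ (Δ[1] : SSet.{v}) ⟶ Z}
    (e : SSet.ι₀ ≫ h = SSet.ι₀ ≫ h') : h = h' := by
  have edge : ∀ (g : W ⊗ (Δ[1] : SSet.{v}) ⟶ Z) (w : W _⦋0⦌) (a : (Δ[1] : SSet.{v}) _⦋0⦌),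
      g.app _ (w, a) = (SSet.ι₀ ≫ g).app _ w := by
    intro g w a
    -- The edge of the cylinder from `(w, 0)` to `(w, 1)`. Every vertex `(w, b)` is a face of it,
    -- and discreteness identifies the images of all its faces.
    let ω : (W ⊗ (Δ[1] : SSet.{v})).obj (op ⦋1⦌) :=
      (W.map (⦋1⦌.const ⦋0⦌ 0).op w, SSet.stdSimplex.objEquiv.symm (𝟙 _))
    have h1 : ∀ b : (Δ[1] : SSet.{v}) _⦋0⦌,
        g.app _ (w, b) = Z.map (SSet.stdSimplex.objEquiv b).op (g.app _ ω) := by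
      intro b
      rw [← NatTrans.naturality_apply]
      congr 1
      refine Prod.ext ?_ ?_
      · change w = W.map (SSet.stdSimplex.objEquiv b).op (W.map (⦋1⦌.const ⦋0⦌ 0).op w)
        exact (map_vertex_map_const _ _ _).symm
      · exact congrArg SSet.stdSimplex.objEquiv.symm
          (Category.comp_id (SSet.stdSimplex.objEquiv b)).symm
    rw [h1 a]
    exact (hZ _ _ _).trans (h1 _).symm
  refine NatTrans.ext (funext fun n => ConcreteCategory.hom_ext _ _ fun x => ?_)
  obtain ⟨n⟩ := n
  apply hZ.map_vertex_injective (⦋0⦌.const n 0)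
  rw [← NatTrans.naturality_apply, ← NatTrans.naturality_apply]
  refine (edge h _ _).trans (Eq.trans ?_ (edge h' _ _).symm)
  rw [e]

end IsDiscrete

/-! ## Homotopy pullbacks over discrete simplicial sets -/

section

variable {W X Y Z : SSet.{v}} {f : X ⟶ Z} {g : Y ⟶ Z}

theorem hoPullback_ext (hZ : IsDiscrete Z) {n : SimplexCategoryᵒᵖ}
    {s t : (hoPullback f g).obj n} (h : s.1.1 = t.1.1) (h' : s.1.2.2 = t.1.2.2) : s = t := by
  apply Subtype.ext
  refine Prod.ext h (Prod.ext (hZ.homotopy_ext ?_) h')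
  rw [s.2.1, t.2.1, h]

/-- A homotopy into a discrete simplicial set is constant, because the constant homotopy has the
same source. Its two ends are therefore equal. -/
theorem hoPullback_compat (hZ : IsDiscrete Z) (t : (hoPullback f g) _⦋0⦌) :
    f.app _ t.1.1 = g.app _ t.1.2.2 := by
  apply SSet.yonedaEquiv.symm.injective
  rw [← t.2.1, ← t.2.2]
  have : t.1.2.1 = CartesianMonoidalCategory.fst _ _ ≫ SSet.ι₀ ≫ t.1.2.1 := by
    apply hZ.homotopy_ext
    rw [← Category.assoc, SSet.ι₀_fst, Category.id_comp]
  rw [this, ← Category.assoc SSet.ι₁, SSet.ι₁_fst, Category.id_comp, ← Category.assoc SSet.ι₀,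
    SSet.ι₀_fst, Category.id_comp]

/-- The simplex `(x, constant homotopy, y)`. -/
def hoPullback.mk {n : SimplexCategoryᵒᵖ} (x : X.obj n) (y : Y.obj n)
    (h : f.app n x = g.app n y) : (hoPullback f g).obj n :=
  ⟨(x, CartesianMonoidalCategory.fst _ _ ≫ SSet.yonedaEquiv.symm (f.app n x), y), by
    refine ⟨?_, ?_⟩
    · rw [← Category.assoc, SSet.ι₀_fst, Category.id_comp]
    · rw [← Category.assoc, SSet.ι₁_fst, Category.id_comp, h]⟩

/-- The projections of the homotopy pullback. -/
def hoPullback.fst (f : X ⟶ Z) (g : Y ⟶ Z) : hoPullback f g ⟶ X where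
  app n := ↾fun t => t.1.1

def hoPullback.snd (f : X ⟶ Z) (g : Y ⟶ Z) : hoPullback f g ⟶ Y where
  app n := ↾fun t => t.1.2.2

theorem hoPullback.map_app_fst {X' Z' : SSet.{v}} {f' : X' ⟶ Z'} {g' : Y ⟶ Z'} (a : X ⟶ X')
    (c : Z ⟶ Z') (hf : f ≫ c = a ≫ f') (hg : g ≫ c = g') {n : SimplexCategoryᵒᵖ}
    (t : (hoPullback f g).obj n) :
    ((hoPullback.map a c hf hg).app n t).1.1 = a.app n t.1.1 := rfl

theorem hoPullback.map_app_snd {X' Z' : SSet.{v}} {f' : X' ⟶ Z'} {g' : Y ⟶ Z'} (a : X ⟶ X')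
    (c : Z ⟶ Z') (hf : f ≫ c = a ≫ f') (hg : g ≫ c = g') {n : SimplexCategoryᵒᵖ}
    (t : (hoPullback f g).obj n) :
    ((hoPullback.map a c hf hg).app n t).1.2.2 = t.1.2.2 := rfl

theorem hoPullback.lift_app_fst (a : W ⟶ X) (b : W ⟶ Y) (h : a ≫ f = b ≫ g)
    {n : SimplexCategoryᵒᵖ} (x : W.obj n) :
    ((hoPullback.lift a b h).app n x).1.1 = a.app n x := rfl

theorem hoPullback.lift_app_snd (a : W ⟶ X) (b : W ⟶ Y) (h : a ≫ f = b ≫ g)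
    {n : SimplexCategoryᵒᵖ} (x : W.obj n) :
    ((hoPullback.lift a b h).app n x).1.2.2 = b.app n x := rfl

theorem hoPullback_fst_eq (hX : IsDiscrete X) {s t : (hoPullback f g) _⦋0⦌}
    (h : SSet.π₀.mk s = SSet.π₀.mk t) : s.1.1 = t.1.1 :=
  hX.eq_of_mk_eq (congrArg (SSet.mapπ₀ (hoPullback.fst f g)) h)

theorem hoPullback_snd_eq {s t : (hoPullback f g) _⦋0⦌} (h : SSet.π₀.mk s = SSet.π₀.mk t) :
    SSet.π₀.mk s.1.2.2 = SSet.π₀.mk t.1.2.2 :=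
  congrArg (SSet.mapπ₀ (hoPullback.snd f g)) h

/-- Over a discrete base, points with the same first coordinate are in the same component if
their second coordinates are. -/
theorem hoPullback_mk_eq (hZ : IsDiscrete Z) (s t : (hoPullback f g) _⦋0⦌) (h : s.1.1 = t.1.1)
    (h' : SSet.π₀.mk s.1.2.2 = SSet.π₀.mk t.1.2.2) : SSet.π₀.mk s = SSet.π₀.mk t := by
  classical
  let x := s.1.1
  -- With the first coordinate `x` fixed, `Φ` sends `y` to the component of `(x, y)`. The default
  -- value is harmless: the condition `f x = g y` is constant along edges of `Y`, since `g` sends an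
  -- edge to an equality, and it holds at both points of interest. So `Φ` descends to the components
  -- of `Y`.
  let Φ : Y _⦋0⦌ → SSet.π₀ (hoPullback f g) := fun y =>
    if h : f.app _ x = g.app _ y then SSet.π₀.mk (hoPullback.mk x y h) else SSet.π₀.mk s
  have hΦ : ∀ ⦃y y' : Y _⦋0⦌⦄ (_ : Y.Edge y y'), Φ y = Φ y' := by
    intro y y' e
    have hg : g.app _ y = g.app _ y' := hZ.eq_of_edge (e.map g)
    by_cases h : f.app _ x = g.app _ y
    · have h2 : f.app _ x = g.app _ y' := h.trans hg
      simp only [Φ, dif_pos h, dif_pos h2]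
      -- The degenerate edge at `x` and the edge `e` have the same image in `Z` because their
      -- sources do, so together they form an edge of the homotopy pullback.
      have h3 : f.app _ (X.map (⦋1⦌.const ⦋0⦌ 0).op x) = g.app _ e.edge := by
        apply hZ.map_vertex_injective (SimplexCategory.δ 1)
        have h4 : Y.map (SimplexCategory.δ 1).op e.edge = y := e.src_eq
        rw [← NatTrans.naturality_apply, ← NatTrans.naturality_apply, map_vertex_map_const, h4, h]
      refine SSet.π₀.sound (SSet.Edge.mk (hoPullback.mk _ e.edge h3) ?_ ?_)
      · refine hoPullback_ext hZ ?_ e.src_eq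
        exact map_vertex_map_const X _ x
      · refine hoPullback_ext hZ ?_ e.tgt_eq
        exact map_vertex_map_const X _ x
    · have h2 : ¬ f.app _ x = g.app _ y' := fun h2 => h (h2.trans hg.symm)
      simp only [Φ, dif_neg h, dif_neg h2]
  have key : Φ s.1.2.2 = Φ t.1.2.2 := congrArg (SSet.π₀.lift Φ hΦ) h'
  have hs : f.app _ x = g.app _ s.1.2.2 := hoPullback_compat hZ s
  have ht : f.app _ x = g.app _ t.1.2.2 :=
    (congrArg (f.app _) h).trans (hoPullback_compat hZ t)
  simp only [Φ, dif_pos hs, dif_pos ht] at key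
  have es : hoPullback.mk x s.1.2.2 hs = s := hoPullback_ext hZ rfl rfl
  have et : hoPullback.mk x t.1.2.2 ht = t := hoPullback_ext hZ h rfl
  rwa [es, et] at key

end

/-! ## Components of homotopy colimits -/

section

variable {P : Type w} [Preorder P] (F : P ⥤ SSet.{max v w})

/-- The component of the point `t` of `F(p)` in the homotopy colimit. -/
def hoColim.class (p : P) (t : (F.obj p) _⦋0⦌) : SSet.π₀ (hoColim.{v, w} F) :=
  SSet.π₀.mk ((hoColim.ι.{v, w} F p).app _ t)

theorem hoColim.class_surjective (z : SSet.π₀ (hoColim.{v, w} F)) :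
    ∃ p t, hoColim.class.{v, w} F p t = z := by
  induction z with
  | mk z =>
    refine ⟨z.1 0, z.2, congrArg SSet.π₀.mk ?_⟩
    refine hoColim_ext.{v, w} F (x := ⟨OrderHom.const _ (z.1 0), z.2⟩) (y := z) ?_ ?_
    · exact OrderHom.ext _ _ (funext fun i => by rw [Subsingleton.elim (α := Fin 1) i 0]; rfl)
    · exact map_endo_app F _ z.2

/-- Functions out of the components of a homotopy colimit. -/
def hoColim.desc {T : Type*} (G : ∀ p, (F.obj p) _⦋0⦌ → T)
    (hG : ∀ p (s t : (F.obj p) _⦋0⦌), SSet.π₀.mk s = SSet.π₀.mk t → G p s = G p t)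
    (hG' : ∀ {p q} (h : p ⟶ q) (t : (F.obj p) _⦋0⦌), G q ((F.map h).app _ t) = G p t) :
    SSet.π₀ (hoColim.{v, w} F) → T :=
  SSet.π₀.lift (fun z => G (z.1 0) z.2) (by
    intro z z' e
    obtain ⟨⟨c, x⟩, h⟩ : ∃ x, x = e.edge := ⟨_, rfl⟩
    have hs := e.src_eq
    have ht := e.tgt_eq
    rw [← h] at hs ht
    subst hs ht
    -- An edge of the homotopy colimit is an edge `x` of `F(p₀)` over `p₀ ≤ p₁`; its source lies in
    -- `F(p₀)` and its target is the target of `x` moved to `F(p₁)`. Both ends have the form treated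
    -- here.
    have face : ∀ {q : P} (h : c 0 ⟶ q) (θ : op ⦋1⦌ ⟶ op ⦋0⦌),
        G q ((F.obj q).map θ ((F.map h).app _ x)) = G (c 0) ((F.obj (c 0)).map θ x) := by
      intro q h θ
      rw [← NatTrans.naturality_apply, hG']
    exact (face _ _).trans ((hG _ _ _ (SSet.π₀.sound (SSet.Edge.mk' x))).trans (face _ _).symm))

theorem hoColim.class_eq_of_mk_eq {p : P} {s t : (F.obj p) _⦋0⦌}
    (h : SSet.π₀.mk s = SSet.π₀.mk t) :
    hoColim.class.{v, w} F p s = hoColim.class.{v, w} F p t :=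
  congrArg (SSet.mapπ₀ (hoColim.ι.{v, w} F p)) h

theorem hoColim.class_map {p q : P} (h : p ⟶ q) (t : (F.obj p) _⦋0⦌) :
    hoColim.class.{v, w} F q ((F.map h).app _ t) = hoColim.class.{v, w} F p t := by
  let c : Fin 2 →o P := ⟨![p, q], by
    intro i j hij
    fin_cases i <;> fin_cases j <;> simp_all [leOfHom h]⟩
  -- The degenerate edge on `t` over the chain `p ≤ q` joins `t` to its image in `F(q)`.
  let ω : (hoColim.{v, w} F).obj (op ⦋1⦌) :=
    ⟨c, (F.obj p).map (⦋1⦌.const ⦋0⦌ 0).op t⟩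
  symm
  refine SSet.π₀.sound (SSet.Edge.mk ω ?_ ?_)
  · refine hoColim_ext.{v, w} F ?_ ?_
    · exact OrderHom.ext _ _ (funext fun i => by rw [Subsingleton.elim (α := Fin 1) i 0]; rfl)
    · change (F.map (𝟙 p)).app _ ((F.obj p).map (SimplexCategory.δ 1).op
        ((F.map (𝟙 p)).app _ ((F.obj p).map (⦋1⦌.const ⦋0⦌ 0).op t))) = t
      rw [map_endo_app, map_endo_app]
      exact map_vertex_map_const _ _ _
  · refine hoColim_ext.{v, w} F ?_ ?_
    · exact OrderHom.ext _ _ (funext fun i => by rw [Subsingleton.elim (α := Fin 1) i 0]; rfl)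
    · change (F.map (𝟙 q)).app _ ((F.obj q).map (SimplexCategory.δ 0).op
        ((F.map h).app _ ((F.obj p).map (⦋1⦌.const ⦋0⦌ 0).op t))) = (F.map h).app _ t
      rw [map_endo_app, ← NatTrans.naturality_apply]
      exact congrArg _ (map_vertex_map_const _ _ _)

/-- In a directed homotopy colimit, components agree only if they agree in some term. -/
theorem hoColim.exists_of_class_eq [IsDirectedOrder P] {p q : P} {s : (F.obj p) _⦋0⦌}
    {t : (F.obj q) _⦋0⦌} (h : hoColim.class.{v, w} F p s = hoColim.class.{v, w} F q t) :
    ∃ (r : P) (hp : p ⟶ r) (hq : q ⟶ r),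
      SSet.π₀.mk ((F.map hp).app _ s) = SSet.π₀.mk ((F.map hq).app _ t) := by
  -- The property of meeting the component of `t` in a later term is treated as a function with
  -- values in propositions. It is constant on components of the homotopy colimit, and it holds for
  -- `t`, hence for `s`.
  let G : ∀ p', (F.obj p') _⦋0⦌ → Prop := fun p' s' => ∃ (r : P) (hp : p' ⟶ r) (hq : q ⟶ r),
      SSet.π₀.mk ((F.map hp).app _ s') = SSet.π₀.mk ((F.map hq).app _ t)
  have hG : ∀ p (s t : (F.obj p) _⦋0⦌), SSet.π₀.mk s = SSet.π₀.mk t → G p s = G p t := by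
    intro p' s' t' h'
    have h2 : ∀ {r : P} (hp : p' ⟶ r), SSet.π₀.mk ((F.map hp).app _ s') =
        SSet.π₀.mk ((F.map hp).app _ t') := fun hp => congrArg (SSet.mapπ₀ (F.map hp)) h'
    simp only [G, h2]
  have hG' : ∀ {p q} (h : p ⟶ q) (t : (F.obj p) _⦋0⦌), G q ((F.map h).app _ t) = G p t := by
    intro p₁ p₂ h₁ s'
    apply propext
    constructor
    · rintro ⟨r, hp, hq, e⟩
      refine ⟨r, h₁ ≫ hp, hq, ?_⟩
      rw [F.map_comp]
      exact e
    · rintro ⟨r, hp, hq, e⟩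
      -- The only use of directedness: agreement in a term above `p₁` is moved to one that is also
      -- above `p₂`.
      obtain ⟨r', h₂, h₃⟩ := exists_ge_ge p₂ r
      refine ⟨r', homOfLE h₂, hq ≫ homOfLE h₃, ?_⟩
      have e' := congrArg (SSet.mapπ₀ (F.map (homOfLE h₃))) e
      rw [F.map_comp]
      refine Eq.trans ?_ e'
      obtain h4 : h₁ ≫ homOfLE h₂ = hp ≫ homOfLE h₃ := Subsingleton.elim _ _
      have h5 := congrArg (fun k => SSet.π₀.mk (k.app _ s')) (congrArg F.map h4)
      simp only [F.map_comp] at h5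
      exact h5
  have key : G p s = G q t := congrArg (hoColim.desc.{v, w} F G hG hG') h
  change G p s
  rw [key]
  exact ⟨q, 𝟙 _, 𝟙 _, rfl⟩

end

/-! ## Closed subobjects of ind-Banach modules -/

/-- A normed group as a normed set. -/
def normSet (V : Type u) [NormedAddCommGroup V] : NSet.{u} := ⟨V, fun v => ‖v‖₊⟩

section Bdd

variable {V W : Type u} [NormedAddCommGroup V] [Module H V] [NormedAddCommGroup W] [Module H W]
  {S T : NSet.{u}}

/-- The identity as a bounded function. -/
def Bdd.ident (V : Type u) [NormedAddCommGroup V] : Bdd (normSet V) V :=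
  ⟨fun v => v, 1, fun v => by
    rw [NNReal.coe_one, one_mul]
    exact le_rfl⟩

/-- The inclusion of a submodule as a bounded function. -/
def Bdd.incl (L : Submodule H V) : Bdd (normSet L) V :=
  ⟨fun v => v.1, 1, fun v => by
    rw [NNReal.coe_one, one_mul]
    exact le_rfl⟩

/-- A bounded function as a bounded map of normed sets. -/
def Bdd.toMap (f : Bdd S V) : NSet.Map S (normSet V) :=
  ⟨f.1, f.2.imp fun C hC s => by exact_mod_cast hC s⟩

/-- Factorization of a bounded function through a submodule that contains its values. -/
def Bdd.factor (f : Bdd S V) (L : Submodule H V) (h : ∀ s, f.1 s ∈ L) : NSet.Map S (normSet L) :=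
  ⟨fun s => ⟨f.1 s, h s⟩, f.2.imp fun C hC s => by exact_mod_cast hC s⟩

theorem bounded_comp {U : Type u} [NormedAddCommGroup U] [Module H U] {φ : V →ₗ[H] W}
    {ψ : W →ₗ[H] U} (hφ : ∃ C : ℝ≥0, ∀ v, ‖φ v‖ ≤ C * ‖v‖)
    (hψ : ∃ C : ℝ≥0, ∀ v, ‖ψ v‖ ≤ C * ‖v‖) : ∃ C : ℝ≥0, ∀ v, ‖(ψ ∘ₗ φ) v‖ ≤ C * ‖v‖ := by
  obtain ⟨C, hC⟩ := hφ
  obtain ⟨D, hD⟩ := hψ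
  refine ⟨D * C, fun v => (hD _).trans ?_⟩
  rw [NNReal.coe_mul, mul_assoc]
  exact mul_le_mul_of_nonneg_left (hC v) D.2

theorem isClosed_ker_of_bounded (φ : V →ₗ[H] W) (hφ : ∃ C : ℝ≥0, ∀ v, ‖φ v‖ ≤ C * ‖v‖) :
    IsClosed (LinearMap.ker φ : Set V) := by
  obtain ⟨C, hC⟩ := hφ
  exact isClosed_singleton.preimage (AddMonoidHomClass.continuous_of_bound φ C hC)

end Bdd

/-- The projection to the quotient by a subpresheaf. -/
def PreMod.quotMk (M : PreMod.{u} H) (K : M.Sub) (S : NSet.{u}) : M.pts S →+ (M.quot K).pts S :=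
  QuotientAddGroup.mk' (K.carrier S)

theorem PreMod.quotMk_eq_zero {M : PreMod.{u} H} {K : M.Sub} {S : NSet.{u}} {x : M.pts S} :
    M.quotMk K S x = 0 ↔ x ∈ K.carrier S :=
  QuotientAddGroup.eq_zero_iff x

/-! ### Closed subobjects in terms of a presentation. -/

namespace IndPresentation

attribute [instance] IndPresentation.pre IndPresentation.dir IndPresentation.ne

variable {κ : Kind} {M : PreMod.{u} H}

/-- Yoneda: every bounded family in a term is pulled back from the tautological family indexed by
the term itself, so natural constructions need to be known on that one family only. -/
theorem of_comp_toMap (P : IndPresentation κ M) (i : P.J) {S : NSet.{u}}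
    (f : Bdd S (P.obj i).carrier) :
    M.pull (Bdd.toMap f) (P.of i (Bdd.ident _)) = P.of i f := P.of_pull i _ _

/-- A family with values in `L` is pulled back from the inclusion of `L`. So the single condition
that this inclusion lies in `K` expresses that `L` is killed in the quotient. -/
theorem of_mem_of_factor (P : IndPresentation κ M) {K : M.Sub} {i : P.J}
    {L : Submodule H (P.obj i).carrier} (hL : P.of i (Bdd.incl L) ∈ K.carrier _) {S : NSet.{u}}
    (f : Bdd S (P.obj i).carrier) (h : ∀ s, f.1 s ∈ L) : P.of i f ∈ K.carrier S := by
  have h1 := K.pull_mem (Bdd.factor f L h) hL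
  rwa [P.of_pull] at h1

/-- A subpresheaf is saturated if in each term of the presentation, its bounded families are
contained in closed submodules that belong to it. -/
structure Saturated (P : IndPresentation κ M) (K : M.Sub) : Prop where
  -- Two families at a time, so that the submodules `L` that occur are directed.
  pair : ∀ (i : P.J) {S T : NSet.{u}} (f : Bdd S (P.obj i).carrier)
    (g : Bdd T (P.obj i).carrier), P.of i f ∈ K.carrier S → P.of i g ∈ K.carrier T →
    ∃ L : Submodule H (P.obj i).carrier, IsClosed (L : Set (P.obj i).carrier) ∧
      P.of i (Bdd.incl L) ∈ K.carrier _ ∧ (∀ s, f.1 s ∈ L) ∧ ∀ t, g.1 t ∈ L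
  -- In the essentially monomorphic case the transition maps between the quotients must be
  -- injective, which forces the choice of the maximal submodule.
  largest : κ.monomorphic = true → ∀ i : P.J, ∃ L : Submodule H (P.obj i).carrier,
    IsClosed (L : Set (P.obj i).carrier) ∧ P.of i (Bdd.incl L) ∈ K.carrier _ ∧
      ∀ {S : NSet.{u}} (f : Bdd S (P.obj i).carrier), P.of i f ∈ K.carrier S → ∀ s, f.1 s ∈ L

/-- Saturated subpresheaves are stable under intersections. -/
theorem Saturated.inter (P : IndPresentation κ M) {A : Type*} (𝒦 : A → M.Sub)
    (h𝒦 : ∀ a, P.Saturated (𝒦 a)) (K : M.Sub)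
    (hK : ∀ (S : NSet.{u}) (x : M.pts S), x ∈ K.carrier S ↔ ∀ a, x ∈ (𝒦 a).carrier S) :
    P.Saturated K := by
  -- The intersection of submodules chosen for the individual members works, since its inclusion
  -- factors through each of them.
  have aux : ∀ (i : P.J) (L : A → Submodule H (P.obj i).carrier),
      (∀ a, P.of i (Bdd.incl (L a)) ∈ (𝒦 a).carrier _) →
      P.of i (Bdd.incl (⨅ a, L a)) ∈ K.carrier _ := by
    intro i L hL
    refine (hK _ _).2 fun a => P.of_mem_of_factor (hL a) _ fun s => ?_
    exact (Submodule.mem_iInf _).1 s.2 a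
  have aux' : ∀ (i : P.J) (L : A → Submodule H (P.obj i).carrier),
      (∀ a, IsClosed (L a : Set (P.obj i).carrier)) →
      IsClosed ((⨅ a, L a : Submodule H (P.obj i).carrier) : Set (P.obj i).carrier) := by
    intro i L hL
    rw [Submodule.coe_iInf]
    exact isClosed_iInter hL
  refine ⟨fun i S T f g hf hg => ?_, fun hm i => ?_⟩
  · choose L hc hL hf' hg' using fun a =>
      (h𝒦 a).pair i f g ((hK _ _).1 hf a) ((hK _ _).1 hg a)
    exact ⟨⨅ a, L a, aux' i L hc, aux i L hL,
      fun s => (Submodule.mem_iInf _).2 fun a => hf' a s,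
      fun t => (Submodule.mem_iInf _).2 fun a => hg' a t⟩
  · choose L hc hL hf' using fun a => (h𝒦 a).largest hm i
    exact ⟨⨅ a, L a, aux' i L hc, aux i L hL,
      fun f hf s => (Submodule.mem_iInf _).2 fun a => hf' a f ((hK _ _).1 hf a) s⟩

/-- If the quotient is ind-Banach, then the projection is given on each term of a presentation
by a bounded linear map into a term of a presentation of the quotient. -/
theorem exists_linear (P : IndPresentation κ M) {K : M.Sub} (P' : IndPresentation κ (M.quot K))
    (i : P.J) : ∃ (j : P'.J) (G : (P.obj i).carrier →ₗ[H] (P'.obj j).carrier)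
      (hG : ∃ C : ℝ≥0, ∀ v, ‖G v‖ ≤ C * ‖v‖), ∀ {S : NSet.{u}} (f : Bdd S (P.obj i).carrier),
        M.quotMk K S (P.of i f) = P'.of j (Bdd.push G hG f) := by
  -- The projection of the tautological family gives a bounded function `g` from the term `i` to a
  -- term of the quotient. It is linear only after passing to a later term.
  obtain ⟨j, g, hg⟩ := P'.of_surj (M.quotMk K _ (P.of i (Bdd.ident _)))
  have key : ∀ {S : NSet.{u}} (f : Bdd S (P.obj i).carrier),
      M.quotMk K S (P.of i f) = P'.of j (Bdd.comp g (Bdd.toMap f)) := by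
    intro S f
    rw [← P'.of_pull, hg, ← P.of_comp_toMap]
    rfl
  let V := (P.obj i).carrier
  -- The universal pair of elements: additivity of `g` at all pairs is one equation between families
  -- on this set, so a single index makes it hold everywhere.
  let S₂ : NSet.{u} := ⟨V × V, fun x => ‖x.1‖₊ + ‖x.2‖₊⟩
  let f₁ : Bdd S₂ V := ⟨fun x => x.1, 1, fun x => by simp [S₂]⟩
  let f₂ : Bdd S₂ V := ⟨fun x => x.2, 1, fun x => by simp [S₂]⟩
  have hadd : P'.of j (Bdd.comp g (Bdd.toMap (f₁ + f₂)) - Bdd.comp g (Bdd.toMap f₁) -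
      Bdd.comp g (Bdd.toMap f₂)) = 0 := by
    rw [map_sub, map_sub, ← key, ← key, ← key, map_add, map_add]
    abel
  obtain ⟨j₁, h₁, e₁⟩ := P'.of_eq_zero j _ hadd
  -- Likewise homogeneity is one equation between families on `H × V`.
  have hsmul : P'.of j (Bdd.comp g (Bdd.toMap (Bdd.smul (Bdd.ident H) (Bdd.ident V))) -
      Bdd.smul (Bdd.ident H) g) = 0 := by
    rw [map_sub, ← key, ← P'.of_act, hg, ← P.of_act, sub_eq_zero]
    rfl
  obtain ⟨j₂, h₂, e₂⟩ := P'.of_eq_zero j _ hsmul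
  obtain ⟨k, hk₁, hk₂⟩ := exists_ge_ge j₁ j₂
  have E₁ : ∀ x y : V, P'.tr (h₁.trans hk₁) (g.1 (x + y)) =
      P'.tr (h₁.trans hk₁) (g.1 x) + P'.tr (h₁.trans hk₁) (g.1 y) := by
    intro x y
    have h : P'.tr h₁ (g.1 (x + y) - g.1 x - g.1 y) = 0 := congrFun (congrArg Subtype.val e₁) (x, y)
    have h' := congrArg (P'.tr hk₁) h
    rw [P'.tr_comp, map_zero, map_sub, map_sub] at h'
    rw [← sub_eq_zero, ← h']
    abel
  have E₂ : ∀ (c : H) (x : V), P'.tr (h₁.trans hk₁) (g.1 (c • x)) =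
      c • P'.tr (h₁.trans hk₁) (g.1 x) := by
    intro c x
    have h : P'.tr h₂ (g.1 (c • x) - c • g.1 x) = 0 := congrFun (congrArg Subtype.val e₂) (c, x)
    have h' := congrArg (P'.tr hk₂) h
    rw [P'.tr_comp, map_zero, map_sub, map_smul, sub_eq_zero] at h'
    exact h'
  refine ⟨k, ⟨⟨fun v => P'.tr (h₁.trans hk₁) (g.1 v), E₁⟩, E₂⟩, ?_, fun {S} f => ?_⟩
  · obtain ⟨C, hC⟩ := (Bdd.push (P'.tr (h₁.trans hk₁)) (P'.tr_bdd _) g).2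
    exact ⟨C, fun v => hC v⟩
  · rw [key, ← P'.of_tr (h₁.trans hk₁)]
    rfl

/-- Closed subobjects are saturated. -/
theorem saturated_of_isClosed (P : IndPresentation κ M) {K : M.Sub} (hK : K.IsClosed κ) :
    P.Saturated K := by
  obtain ⟨P'⟩ := hK
  refine ⟨fun i S T f g hf hg => ?_, fun hm i => ?_⟩
  · obtain ⟨j, G, hG, key⟩ := P.exists_linear P' i
    rw [← PreMod.quotMk_eq_zero, key] at hf hg
    obtain ⟨j₁, h₁, e₁⟩ := P'.of_eq_zero j _ hf
    obtain ⟨j₂, h₂, e₂⟩ := P'.of_eq_zero j _ hg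
    obtain ⟨k, hk₁, hk₂⟩ := exists_ge_ge j₁ j₂
    have hb := bounded_comp hG (P'.tr_bdd (h₁.trans hk₁))
    -- Both families die in the term `k` of the quotient, so the kernel of the bounded map to that
    -- term contains their values. It is closed and vanishes in the quotient.
    refine ⟨LinearMap.ker (P'.tr (h₁.trans hk₁) ∘ₗ G), isClosed_ker_of_bounded _ hb, ?_, ?_, ?_⟩
    · rw [← PreMod.quotMk_eq_zero, key, ← P'.of_tr (h₁.trans hk₁)]
      refine (congrArg (P'.of k) (Subtype.ext (funext fun s => ?_))).trans (map_zero _)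
      exact s.2
    · intro s
      have h : P'.tr h₁ (G (f.1 s)) = 0 := congrFun (congrArg Subtype.val e₁) s
      rw [LinearMap.mem_ker, LinearMap.comp_apply, ← P'.tr_comp h₁ hk₁, h, map_zero]
    · intro s
      have h : P'.tr h₂ (G (g.1 s)) = 0 := congrFun (congrArg Subtype.val e₂) s
      rw [LinearMap.mem_ker, LinearMap.comp_apply, ← P'.tr_comp h₂ hk₂, h, map_zero]
  · obtain ⟨j, G, hG, key⟩ := P.exists_linear P' i
    -- With injective transition maps, whatever dies later in the quotient is already zero in the
    -- term `j`, so the kernel of `G` is the largest choice.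
    refine ⟨LinearMap.ker G, isClosed_ker_of_bounded _ hG, ?_, fun {S} f hf s => ?_⟩
    · rw [← PreMod.quotMk_eq_zero, key]
      refine (congrArg (P'.of j) (Subtype.ext (funext fun s => ?_))).trans (map_zero _)
      exact s.2
    · rw [← PreMod.quotMk_eq_zero, key] at hf
      obtain ⟨k, h, e⟩ := P'.of_eq_zero j _ hf
      have h' : P'.tr h (G (f.1 s)) = 0 := congrFun (congrArg Subtype.val e) s
      exact P'.tr_inj hm h (h'.trans (map_zero _).symm)

end IndPresentation

/-! ## Quotients of Banach modules -/

section Quotient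

variable {V : Type u} [NormedAddCommGroup V] [Module H V] (L : Submodule H V)

theorem isUltrametricDist_quotient [IsUltrametricDist V] : IsUltrametricDist (V ⧸ L) := by
  refine IsUltrametricDist.isUltrametricDist_of_forall_norm_add_le_max_norm fun x y => ?_
  refine le_of_forall_pos_le_add fun ε hε => ?_
  obtain ⟨v, rfl, hv⟩ := Submodule.Quotient.norm_mk_lt x hε
  obtain ⟨w, rfl, hw⟩ := Submodule.Quotient.norm_mk_lt y hε
  refine (Submodule.Quotient.norm_mk_le L (v + w)).trans ?_
  refine (IsUltrametricDist.norm_add_le_max v w).trans ?_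
  rw [max_add]
  exact max_le_max hv.le hw.le

variable [hL : IsClosed (L : Set V)]

/-- The quotient norm is an infimum over lifts, so any factor greater than `1` is enough when `‖x‖ >
0`. Closedness of `L` guarantees this for `x ≠ 0`, and `0` is lifted to `0`. -/
theorem exists_mk_eq_norm_le (x : V ⧸ L) :
    ∃ v : V, Submodule.Quotient.mk v = x ∧ ‖v‖ ≤ 2 * ‖x‖ := by
  rcases eq_or_ne x 0 with rfl | hx
  · exact ⟨0, rfl, by simp⟩
  · obtain ⟨v, hv, h⟩ := Submodule.Quotient.norm_mk_lt x (norm_pos_iff.2 hx)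
    exact ⟨v, hv, by linarith⟩

theorem mkQ_bounded : ∃ C : ℝ≥0, ∀ v, ‖L.mkQ v‖ ≤ C * ‖v‖ :=
  ⟨1, fun v => by simpa using Submodule.Quotient.norm_mk_le L v⟩

/-- Projectivity of free Banach modules: values are lifted one by one with control of the norm, and
no linearity in the index is required. -/
theorem Bdd.exists_push_mkQ {S : NSet.{u}} (x : Bdd S (V ⧸ L)) :
    ∃ f : Bdd S V, Bdd.push L.mkQ (mkQ_bounded L) f = x := by
  choose v hv hv' using exists_mk_eq_norm_le L
  obtain ⟨C, hC⟩ := x.2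
  refine ⟨⟨fun s => v (x.1 s), 2 * C, fun s => (hv' _).trans ?_⟩,
    Subtype.ext (funext fun s => hv _)⟩
  push_cast
  linarith [hC s]

theorem mapQ_bounded {W : Type u} [NormedAddCommGroup W] [Module H W] (L' : Submodule H W)
    [IsClosed (L' : Set W)] (φ : V →ₗ[H] W) (hφ : ∃ C : ℝ≥0, ∀ v, ‖φ v‖ ≤ C * ‖v‖)
    (h : L ≤ L'.comap φ) : ∃ C : ℝ≥0, ∀ x, ‖L.mapQ L' φ h x‖ ≤ C * ‖x‖ := by
  obtain ⟨C, hC⟩ := hφ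
  refine ⟨C * 2, fun x => ?_⟩
  obtain ⟨v, rfl, hv⟩ := exists_mk_eq_norm_le L x
  refine (Submodule.Quotient.norm_mk_le L' (φ v)).trans ((hC v).trans ?_)
  rw [NNReal.coe_mul, mul_assoc]
  exact mul_le_mul_of_nonneg_left hv C.2

end Quotient

/-! ### Presentations of quotients of ind-Banach modules. -/

namespace IndPresentation

variable {κ : Kind} {M : PreMod.{u} H} (P : IndPresentation κ M) (K : M.Sub)

/-- The index set of the presentation of a quotient: closed submodules of the terms that belong
to the subobject, in the essentially monomorphic case the largest ones. -/
structure QuotIndex : Type u where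
  idx : P.J
  sub : Submodule H (P.obj idx).carrier
  closed : IsClosed (sub : Set (P.obj idx).carrier)
  mem : P.of idx (Bdd.incl sub) ∈ K.carrier _
  largest : κ.monomorphic = true → ∀ {S : NSet.{u}} (f : Bdd S (P.obj idx).carrier),
    P.of idx f ∈ K.carrier S → ∀ s, f.1 s ∈ sub

namespace QuotIndex

attribute [instance] QuotIndex.closed

variable {P K}

instance : Preorder (QuotIndex P K) where
  le a b := ∃ h : a.idx ≤ b.idx, a.sub ≤ b.sub.comap (P.tr h)
  le_refl a := ⟨le_rfl, fun v hv => by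
    rw [Submodule.mem_comap, P.tr_id]
    exact hv⟩
  le_trans a b c h h' := by
    obtain ⟨h₁, e₁⟩ := h
    obtain ⟨h₂, e₂⟩ := h'
    refine ⟨h₁.trans h₂, fun v hv => ?_⟩
    rw [Submodule.mem_comap, ← P.tr_comp h₁ h₂]
    exact e₂ (e₁ hv)

theorem idx_le {a b : QuotIndex P K} (h : a ≤ b) : a.idx ≤ b.idx := h.1

theorem sub_le {a b : QuotIndex P K} (h : a ≤ b) : a.sub ≤ b.sub.comap (P.tr (idx_le h)) := h.2

/-- The largest submodule contains the values of all families of `K`, so it serves in the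
monomorphic case; otherwise `pair` applies and the maximality condition is vacuous. The last
conjunct holds trivially and serves to pin down `hl` as that condition. -/
theorem exists_of_pair (hK : P.Saturated K) (i : P.J) {S T : NSet.{u}}
    (f : Bdd S (P.obj i).carrier) (g : Bdd T (P.obj i).carrier) (hf : P.of i f ∈ K.carrier S)
    (hg : P.of i g ∈ K.carrier T) :
    ∃ L : Submodule H (P.obj i).carrier, ∃ (hc : IsClosed (L : Set (P.obj i).carrier))
      (hm : P.of i (Bdd.incl L) ∈ K.carrier _) (hl : _), (∀ s, f.1 s ∈ L) ∧ (∀ t, g.1 t ∈ L) ∧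
        (⟨i, L, hc, hm, hl⟩ : QuotIndex P K).idx = i := by
  by_cases h : κ.monomorphic = true
  · obtain ⟨L, hc, hm, hl⟩ := hK.largest h i
    exact ⟨L, hc, hm, fun _ => hl, hl f hf, hl g hg, rfl⟩
  · obtain ⟨L, hc, hm, hf', hg'⟩ := hK.pair i f g hf hg
    exact ⟨L, hc, hm, fun h' => absurd h' h, hf', hg', rfl⟩

/-- Move both submodules to a common term, as families given by their inclusions, and take a closed
submodule containing both. -/
theorem directed (hK : P.Saturated K) : IsDirected (QuotIndex P K) (· ≤ ·) := by
  refine ⟨fun a b => ?_⟩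
  obtain ⟨i, ha, hb⟩ := exists_ge_ge a.idx b.idx
  obtain ⟨L, hc, hm, hl, hf, hg, -⟩ := exists_of_pair hK i
    (Bdd.push (P.tr ha) (P.tr_bdd ha) (Bdd.incl a.sub))
    (Bdd.push (P.tr hb) (P.tr_bdd hb) (Bdd.incl b.sub))
    (by rw [P.of_tr]; exact a.mem) (by rw [P.of_tr]; exact b.mem)
  exact ⟨⟨i, L, hc, hm, hl⟩, ⟨ha, fun v hv => hf ⟨v, hv⟩⟩, ⟨hb, fun v hv => hg ⟨v, hv⟩⟩⟩

theorem exists_of_idx (hK : P.Saturated K) (i : P.J) :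
    ∃ a : QuotIndex P K, a.idx = i := by
  obtain ⟨L, hc, hm, hl, -⟩ := exists_of_pair hK i (0 : Bdd NSet.pt _) (0 : Bdd NSet.pt _)
    (by rw [map_zero]; exact zero_mem _) (by rw [map_zero]; exact zero_mem _)
  exact ⟨⟨i, L, hc, hm, hl⟩, rfl⟩

/-- The term `P_i / L`. -/
noncomputable def obj (a : QuotIndex P K) : BanMod.{u} H where
  carrier := (P.obj a.idx).carrier ⧸ a.sub

/-- Two lifts of one family to `P_i` differ by a family in the submodule, which vanishes in the
quotient. This makes the structure map below independent of the chosen lifts, hence additive. -/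
theorem quotMk_of_eq (a : QuotIndex P K) {S : NSet.{u}} {f g : Bdd S (P.obj a.idx).carrier}
    (h : Bdd.push a.sub.mkQ (mkQ_bounded a.sub) f = Bdd.push a.sub.mkQ (mkQ_bounded a.sub) g) :
    M.quotMk K S (P.of a.idx f) = M.quotMk K S (P.of a.idx g) := by
  rw [← sub_eq_zero, ← map_sub, ← map_sub, PreMod.quotMk_eq_zero]
  refine P.of_mem_of_factor a.mem _ fun s => ?_
  exact (Submodule.Quotient.eq a.sub).1 (congrFun (congrArg Subtype.val h) s)

/-- The structure map of the term `P_i / L`. -/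
noncomputable def of (a : QuotIndex P K) (S : NSet.{u}) :
    Bdd S ((P.obj a.idx).carrier ⧸ a.sub) →+ (M.quot K).pts S :=
  AddMonoidHom.mk'
    (fun x => M.quotMk K S (P.of a.idx (Bdd.exists_push_mkQ a.sub x).choose)) (fun x y => by
      rw [← map_add, ← map_add]
      apply a.quotMk_of_eq
      rw [(Bdd.exists_push_mkQ a.sub (x + y)).choose_spec]
      refine Subtype.ext (funext fun s => ?_)
      have hx := congrFun (congrArg Subtype.val (Bdd.exists_push_mkQ a.sub x).choose_spec) s
      have hy := congrFun (congrArg Subtype.val (Bdd.exists_push_mkQ a.sub y).choose_spec) s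
      exact (congrArg₂ (· + ·) hx hy).symm)

theorem of_push (a : QuotIndex P K) {S : NSet.{u}} (f : Bdd S (P.obj a.idx).carrier) :
    a.of S (Bdd.push a.sub.mkQ (mkQ_bounded a.sub) f) = M.quotMk K S (P.of a.idx f) :=
  a.quotMk_of_eq (Bdd.exists_push_mkQ a.sub _).choose_spec

end QuotIndex

open QuotIndex in
/-- The presentation of the quotient by a saturated subpresheaf. -/
noncomputable def quotPresentation (hK : P.Saturated K) : IndPresentation κ (M.quot K) where
  J := QuotIndex P K
  dir := directed hK
  ne := (exists_of_idx hK (Classical.arbitrary P.J)).nonempty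
  obj a := a.obj
  tr {a b} h := a.sub.mapQ b.sub (P.tr (idx_le h)) (sub_le h)
  tr_bdd {a b} h := mapQ_bounded a.sub b.sub _ (P.tr_bdd (idx_le h)) (sub_le h)
  tr_id a x := by
    obtain ⟨v, rfl⟩ := Submodule.Quotient.mk_surjective _ x
    exact congrArg (Submodule.Quotient.mk (p := a.sub)) (P.tr_id _ v)
  tr_comp {a b c} h h' x := by
    obtain ⟨v, rfl⟩ := Submodule.Quotient.mk_surjective _ x
    exact congrArg (Submodule.Quotient.mk (p := c.sub)) (P.tr_comp _ _ v)
  tr_inj hm {a b} h := by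
    refine (injective_iff_map_eq_zero (a.sub.mapQ b.sub (P.tr (idx_le h)) (sub_le h))).2 ?_
    intro x hx
    obtain ⟨v, rfl⟩ := Submodule.Quotient.mk_surjective _ x
    have hv : P.tr (idx_le h) v ∈ b.sub := (Submodule.Quotient.mk_eq_zero _).1 hx
    refine (Submodule.Quotient.mk_eq_zero _).2 ?_
    -- The element `v` as a family on one point; it lies in `K` because it does so after transition,
    -- and maximality of `a.sub` then puts `v` in `a.sub`.
    let f : Bdd ⟨PUnit, fun _ => ‖v‖₊⟩ (P.obj a.idx).carrier := ⟨fun _ => v, 1, fun _ => by simp⟩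
    refine a.largest hm f ?_ PUnit.unit
    rw [← P.of_tr (idx_le h)]
    exact P.of_mem_of_factor b.mem _ fun _ => hv
  ultra hu a := by
    have := P.ultra hu a.idx
    exact isUltrametricDist_quotient a.sub
  of a S := a.of S
  of_tr {a b} h S x := by
    obtain ⟨f, rfl⟩ := Bdd.exists_push_mkQ a.sub x
    refine (b.of_push (Bdd.push (P.tr (idx_le h)) (P.tr_bdd _) f)).trans ?_
    rw [P.of_tr]
    exact (a.of_push f).symm
  of_pull a S T p x := by
    obtain ⟨f, rfl⟩ := Bdd.exists_push_mkQ a.sub x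
    refine (congrArg ((M.quot K).pull p) (a.of_push f)).trans ?_
    refine Eq.trans ?_ (a.of_push (Bdd.comp f p)).symm
    rw [← P.of_pull]
    rfl
  of_act a T S b x := by
    obtain ⟨f, rfl⟩ := Bdd.exists_push_mkQ a.sub x
    refine (congrArg ((M.quot K).act b) (a.of_push f)).trans ?_
    refine Eq.trans ?_ (a.of_push (Bdd.smul b f)).symm
    rw [← P.of_act]
    rfl
  of_surj {S} y := by
    obtain ⟨y, rfl⟩ := QuotientAddGroup.mk'_surjective _ y
    obtain ⟨i, f, rfl⟩ := P.of_surj y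
    obtain ⟨a, rfl⟩ := exists_of_idx hK i
    exact ⟨a, _, a.of_push f⟩
  of_eq_zero a S x hx := by
    obtain ⟨f, rfl⟩ := Bdd.exists_push_mkQ a.sub x
    replace hx := PreMod.quotMk_eq_zero.1 ((a.of_push f).symm.trans hx)
    -- The index in `J` stays the same: the family is killed by enlarging `a.sub` to a submodule
    -- that also contains the values of its lift.
    obtain ⟨L, hc, hm, hl, hf, hg, -⟩ := exists_of_pair hK a.idx f (Bdd.incl a.sub) hx a.mem
    refine ⟨⟨a.idx, L, hc, hm, hl⟩, ⟨le_rfl, fun v hv => ?_⟩, ?_⟩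
    · rw [Submodule.mem_comap, P.tr_id]
      exact hg ⟨v, hv⟩
    · refine Subtype.ext (funext fun s => ?_)
      refine (Submodule.Quotient.mk_eq_zero L).2 ?_
      rw [P.tr_id]
      exact hf s

end IndPresentation

/-! ## Quotients by closed spans -/

section

variable {κ : Kind}

/-- Intersections of closed subobjects are closed. -/
theorem PreMod.Sub.IsClosed.inter {M : PreMod.{u} H} (hM : IsInd κ M) {A : Type*} (𝒦 : A → M.Sub)
    (h𝒦 : ∀ a, (𝒦 a).IsClosed κ) (K : M.Sub)
    (hK : ∀ (S : NSet.{u}) (x : M.pts S), x ∈ K.carrier S ↔ ∀ a, x ∈ (𝒦 a).carrier S) :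
    K.IsClosed κ := by
  obtain ⟨P⟩ := hM
  exact ⟨P.quotPresentation K
    (.inter P 𝒦 (fun a => P.saturated_of_isClosed (h𝒦 a)) K hK)⟩

/-- The closed span is by definition an intersection of closed ideals, so it is closed itself. This
is what keeps `π₀(R)` and its quotients within ind-Banach algebras. -/
theorem PreAlg.isClosed_closedSpan {A : PreAlg.{u} H} (hA : IsInd κ A.toPreMod)
    (X : ∀ S, Set (A.pts S)) : (A.closedSpan κ X).IsClosed κ :=
  .inter hA (fun K : {K : A.Idl // K.IsClosed κ ∧ ∀ S, X S ⊆ K.carrier S} => K.1.toSub)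
    (fun K => K.2.1) _ fun _ _ => AddSubgroup.mem_iInf

theorem PreAlg.subset_closedSpan (A : PreAlg.{u} H) (X : ∀ S, Set (A.pts S)) (S : NSet.{u}) :
    X S ⊆ (A.closedSpan κ X).carrier S :=
  fun _ hx => AddSubgroup.mem_iInf.2 fun K => K.2.2 S hx

theorem PreAlg.closedSpan_le {A : PreAlg.{u} H} {X : ∀ S, Set (A.pts S)} (K : A.Idl)
    (hK : K.IsClosed κ) (h : ∀ S, X S ⊆ K.carrier S) (S : NSet.{u}) :
    (A.closedSpan κ X).carrier S ≤ K.carrier S :=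
  fun _ hx => AddSubgroup.mem_iInf.1 hx ⟨K, hK, h⟩

theorem isInd_piZero {R : SPre.{u} H} (hR : IsSimpInd κ R) : IsInd κ (piZero κ R).toPreMod :=
  PreAlg.isClosed_closedSpan (hR (op ⦋0⦌)) _

theorem isInd_modIdeal {A : PreAlg.{u} H} (hA : IsInd κ A.toPreMod) (I : Ideal A.Ring) :
    IsInd κ (A.modIdeal κ I).toPreMod :=
  PreAlg.isClosed_closedSpan hA _

/-- Ind-Banach modules are stable under isomorphisms. -/
theorem IsInd.of_bijective {M N : PreMod.{u} H} (hM : IsInd κ M) (φ : PreMod.Hom N M)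
    (hφ : ∀ S, Function.Bijective (φ.app S)) : IsInd κ N := by
  obtain ⟨P⟩ := hM
  let e : ∀ S, N.pts S ≃+ M.pts S := fun S => AddEquiv.ofBijective (φ.app S) (hφ S)
  have he : ∀ S x, φ.app S ((e S).symm x) = x := fun S x => (e S).apply_symm_apply x
  exact ⟨{
    J := P.J
    obj := P.obj
    tr := P.tr
    tr_bdd := P.tr_bdd
    tr_id := P.tr_id
    tr_comp := P.tr_comp
    tr_inj := P.tr_inj
    ultra := P.ultra
    of := fun i S => (e S).symm.toAddMonoidHom.comp (P.of i)
    of_tr := fun h S x => congrArg (e S).symm (P.of_tr h x)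
    of_pull := fun i S T f x => (hφ S).1 <| by
      rw [φ.app_pull]
      exact (congrArg _ (he T _)).trans ((P.of_pull i f x).trans (he S _).symm)
    of_act := fun i T S b x => (hφ _).1 <| by
      rw [φ.app_act]
      exact (congrArg _ (he S _)).trans ((P.of_act i b x).trans (he _ _).symm)
    of_surj := fun {S} y => by
      obtain ⟨i, f, hf⟩ := P.of_surj (φ.app S y)
      exact ⟨i, f, (e S).symm_apply_eq.2 hf⟩
    of_eq_zero := fun i S x hx => P.of_eq_zero i x ((e S).symm.injective
      (hx.trans (map_zero _).symm)) }⟩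

end

/-! ## Kernels and quotients of algebras -/

section

variable {κ : Kind}

/-- The value of a morphism of algebras at `S`. -/
def PreAlg.ev {A B : PreAlg.{u} H} (g : A ⟶ B) (S : NSet.{u}) : A.pts S →+ B.pts S :=
  (PreAlg.Hom.toHom g).app S

theorem PreAlg.ev_pull {A B : PreAlg.{u} H} (g : A ⟶ B) {S T : NSet.{u}} (p : NSet.Map S T)
    (x : A.pts T) : PreAlg.ev g S (A.pull p x) = B.pull p (PreAlg.ev g T x) :=
  (PreAlg.Hom.toHom g).app_pull p x

theorem PreAlg.ev_act {A B : PreAlg.{u} H} (g : A ⟶ B) {S T : NSet.{u}} (b : Bdd T H)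
    (x : A.pts S) : PreAlg.ev g _ (A.act b x) = B.act b (PreAlg.ev g S x) :=
  (PreAlg.Hom.toHom g).app_act b x

theorem PreAlg.ev_mul {A B : PreAlg.{u} H} (g : A ⟶ B) {S T : NSet.{u}} (x : A.pts S)
    (y : A.pts T) : PreAlg.ev g _ (A.mul x y) = B.mul (PreAlg.ev g S x) (PreAlg.ev g T y) :=
  PreAlg.Hom.app_mul g x y

theorem PreAlg.hom_ext {A B : PreAlg.{u} H} {g g' : A ⟶ B}
    (h : ∀ S x, PreAlg.ev g S x = PreAlg.ev g' S x) : g = g' :=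
  PreAlg.Hom.ext (funext fun S => AddMonoidHom.ext (h S))

/-- The map of underlying rings. -/
def PreAlg.ringHom {A B : PreAlg.{u} H} (g : A ⟶ B) : A.Ring →+* B.Ring where
  toFun x := PreAlg.ev g NSet.pt x
  map_one' := PreAlg.Hom.app_one g
  map_zero' := map_zero (PreAlg.ev g NSet.pt)
  map_add' x y := map_add (PreAlg.ev g NSet.pt) x y
  map_mul' _ _ := (PreAlg.ev_pull g _ _).trans (congrArg _ (PreAlg.ev_mul g _ _))

/-- The kernel of a morphism of algebras. -/
def PreAlg.ker {A B : PreAlg.{u} H} (g : A ⟶ B) : A.Idl where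
  carrier S := (PreAlg.ev g S).ker
  pull_mem p x hx := by
    rw [AddMonoidHom.mem_ker] at hx ⊢
    rw [PreAlg.ev_pull, hx, map_zero]
  act_mem b x hx := by
    rw [AddMonoidHom.mem_ker] at hx ⊢
    rw [PreAlg.ev_act, hx, map_zero]
  mul_mem {S T x} y hx := by
    rw [AddMonoidHom.mem_ker] at hx ⊢
    rw [PreAlg.ev_mul, hx, map_zero, AddMonoidHom.zero_apply]

/-- The morphism induced on a quotient. -/
def PreAlg.quotLift {A B : PreAlg.{u} H} (K : A.Idl) (g : A ⟶ B)
    (h : ∀ S, K.carrier S ≤ (PreAlg.ker g).carrier S) : A.quot K ⟶ B :=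
  PreAlg.Hom.mk
    { app := fun S => QuotientAddGroup.lift (K.carrier S) (PreAlg.ev g S) (h S)
      app_pull := fun p x => by
        induction x using QuotientAddGroup.induction_on with
        | H x => exact PreAlg.ev_pull g p x
      app_act := fun b x => by
        induction x using QuotientAddGroup.induction_on with
        | H x => exact PreAlg.ev_act g b x }
    (PreAlg.Hom.app_one g) (by
      intro _ _ x y
      induction x using QuotientAddGroup.induction_on with
      | H x =>
        induction y using QuotientAddGroup.induction_on with
        | H y => exact PreAlg.ev_mul g x y)

theorem PreAlg.proj_surjective (A : PreAlg.{u} H) (K : A.Idl) (S : NSet.{u}) :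
    Function.Surjective (PreAlg.ev (A.proj K) S) :=
  QuotientAddGroup.mk'_surjective _

theorem PreAlg.proj_cancel {A B : PreAlg.{u} H} {K : A.Idl} {g g' : A.quot K ⟶ B}
    (h : A.proj K ≫ g = A.proj K ≫ g') : g = g' := by
  refine PreAlg.hom_ext fun S x => ?_
  obtain ⟨x, rfl⟩ := A.proj_surjective K S x
  exact congrArg (fun k => PreAlg.ev k S x) h

/-- The kernel of a surjective morphism to an ind-Banach algebra is closed. -/
theorem PreAlg.isClosed_ker {A B : PreAlg.{u} H} (hB : IsInd κ B.toPreMod) (g : A ⟶ B)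
    (hg : ∀ S, Function.Surjective (PreAlg.ev g S)) : (PreAlg.ker g).IsClosed κ := by
  refine hB.of_bijective (PreAlg.Hom.toHom (PreAlg.quotLift (PreAlg.ker g) g fun _ => le_rfl))
    fun S => ⟨?_, fun y => ?_⟩
  · exact QuotientAddGroup.kerLift_injective (PreAlg.ev g S)
  · obtain ⟨x, rfl⟩ := hg S y
    exact ⟨PreAlg.ev (A.proj _) S x, rfl⟩

/-- For ideals `I ≤ J` with `J` nilpotent, the projection `π₀(R)/I ⟶ π₀(R)/J` refines a
projection of the discrete simplicial algebra `π₀(R)/I` to the quotient by a nilpotent ideal. -/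
theorem exists_nilpotent_refinement {R : SPre.{u} H} (hR : IsSimpInd κ R)
    {I J : Ideal (piZero κ R).Ring} (h : I ⟶ J) (hJ : IsNilpotent J) :
    ∃ J' : Ideal (piZero κ (discreteQuot κ R I)).Ring, IsNilpotent J' ∧
      ∃ g : discreteQuot κ R J ⟶ discreteQuot κ (discreteQuot κ R I) J',
        discreteQuotMap κ R h ≫ g = toDiscreteQuot κ (discreteQuot κ R I) J' := by
  let A := piZero κ R
  let E := discreteQuot κ R I
  have hA : IsInd κ A.toPreMod := isInd_piZero hR
  have hE : IsSimpInd κ E := fun _ => isInd_modIdeal hA I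
  -- There is no need to identify `π₀` of the discrete algebra `E` with `π₀(R)/I`; it is enough that
  -- `π₀(R)` surjects onto it, and `J'` is the ideal generated by the image of `J`.
  let q : A ⟶ piZero κ E := A.proj (A.closedIdeal κ I) ≫ piZeroProj κ E
  let J' : Ideal (piZero κ E).Ring := J.map (PreAlg.ringHom q)
  let r : piZero κ E ⟶ (piZero κ E).modIdeal κ J' :=
    (piZero κ E).proj ((piZero κ E).closedIdeal κ J')
  have hsurj : ∀ S, Function.Surjective (PreAlg.ev (q ≫ r) S) := fun S =>
    ((PreAlg.proj_surjective _ _ S).comp (PreAlg.proj_surjective _ _ S)).comp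
      (PreAlg.proj_surjective _ _ S)
  -- The composite to `π₀(E)/J'` is surjective with ind-Banach target, so its kernel is a closed
  -- ideal. It contains `J`, hence also the closed ideal generated by `J`.
  have hker : ∀ S, (A.closedIdeal κ J).carrier S ≤ (PreAlg.ker (q ≫ r)).carrier S := by
    refine PreAlg.closedSpan_le _
      (PreAlg.isClosed_ker (isInd_modIdeal (isInd_piZero hE) J') _ hsurj) fun S x hx => ?_
    obtain ⟨y, hy, f, rfl⟩ := hx
    refine (PreAlg.ker (q ≫ r)).pull_mem f ?_
    refine (QuotientAddGroup.eq_zero_iff _).2 (PreAlg.subset_closedSpan _ _ _ ?_)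
    exact ⟨PreAlg.ringHom q y, Ideal.mem_map_of_mem _ hy, NSet.Map.id _, PreMod.pull_id _ _⟩
  refine ⟨J', ?_, (SimplicialObject.const _).map (PreAlg.quotLift _ (q ≫ r) hker), ?_⟩
  · obtain ⟨n, hn⟩ := hJ
    refine ⟨n, ?_⟩
    rw [← Ideal.map_pow, hn]
    exact Ideal.map_bot
  · apply NatTrans.ext
    funext n
    apply PreAlg.proj_cancel
    rfl

end

/-! ## Mapping spaces to discrete algebras -/

/-- An `n`-simplex is a compatible family of maps `Q_c → C` indexed by the operators `[c] → [n]`. As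
the target is constant, each is determined by the map `Q₀ → C` attached to a vertex of `[n]`, and
vertices joined by an edge give the same map. So the operator acting on the simplex makes no
difference. -/
theorem isDiscrete_mapSpace_const (Q : SPre.{u} H) (C : PreAlg.{u} H) :
    IsDiscrete (mapSpace Q ((SimplicialObject.const (PreAlg.{u} H)).obj C)) := by
  have nat : ∀ {n : SimplexCategory}
      (x : (mapSpace Q ((SimplicialObject.const (PreAlg.{u} H)).obj C)).obj (op n))
      {c d : SimplexCategoryᵒᵖ} (a : op n ⟶ c) (k : c ⟶ d),
      Q.map k ≫ Functor.HomObj.app x d (a ≫ k) = Functor.HomObj.app x c a := fun x c d a k =>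
    (Functor.HomObj.naturality x k a).trans (Category.comp_id _)
  have vertex_le : ∀ {n : SimplexCategory}
      (x : (mapSpace Q ((SimplicialObject.const (PreAlg.{u} H)).obj C)).obj (op n))
      {i j : Fin (n.len + 1)}, i ≤ j → Functor.HomObj.app x (op ⦋0⦌) (⦋0⦌.const n i).op =
        Functor.HomObj.app x (op ⦋0⦌) (⦋0⦌.const n j).op := by
    intro n x i j hij
    obtain ⟨n⟩ := n
    -- Composing with the degeneracy recovers the map at either end of an edge from the map at the
    -- edge, by a formula that does not involve `k`.
    have face : ∀ k : Fin 2, Functor.HomObj.app x (op ⦋0⦌)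
        ((SimplexCategory.mkOfLe i j hij).op ≫ (SimplexCategory.δ k).op) =
        Q.map (SimplexCategory.σ 0).op ≫
          Functor.HomObj.app x (op ⦋1⦌) (SimplexCategory.mkOfLe i j hij).op := by
      intro k
      have h : Q.map (SimplexCategory.σ 0).op ≫ Q.map (SimplexCategory.δ k).op =
          𝟙 (Q.obj (op ⦋0⦌)) := by
        have : (SimplexCategory.σ (n := 0) 0).op ≫ (SimplexCategory.δ k).op = 𝟙 (op ⦋0⦌) :=
          Quiver.Hom.unop_inj (Subsingleton.elim _ _)
        rw [← Functor.map_comp, this, CategoryTheory.Functor.map_id]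
      rw [← nat x _ (SimplexCategory.δ k).op, ← Category.assoc, h, Category.id_comp]
    have h0 : SimplexCategory.δ (n := 0) 0 ≫ SimplexCategory.mkOfLe i j hij =
        ⦋0⦌.const ⦋n⦌ j := by
      ext k
      fin_cases k
      rfl
    have h1 : SimplexCategory.δ (n := 0) 1 ≫ SimplexCategory.mkOfLe i j hij =
        ⦋0⦌.const ⦋n⦌ i := by
      ext k
      fin_cases k
      rfl
    rw [← h0, ← h1]
    exact (face 1).trans (face 0).symm
  have vertex : ∀ {n : SimplexCategory}
      (x : (mapSpace Q ((SimplicialObject.const (PreAlg.{u} H)).obj C)).obj (op n))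
      (a b : op n ⟶ op ⦋0⦌),
        Functor.HomObj.app x (op ⦋0⦌) a = Functor.HomObj.app x (op ⦋0⦌) b := by
    intro n x a b
    have ha : a = (⦋0⦌.const n (a.unop.toOrderHom 0)).op :=
      Quiver.Hom.unop_inj (SimplexCategory.eq_const_of_zero a.unop)
    have hb : b = (⦋0⦌.const n (b.unop.toOrderHom 0)).op :=
      Quiver.Hom.unop_inj (SimplexCategory.eq_const_of_zero b.unop)
    rw [ha, hb]
    rcases le_total (a.unop.toOrderHom 0) (b.unop.toOrderHom 0) with h | h
    · exact vertex_le x h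
    · exact (vertex_le x h).symm
  intro m n θ θ' x
  refine Functor.functorHom_ext fun c a => ?_
  change Functor.HomObj.app x c (θ.op ≫ a) = Functor.HomObj.app x c (θ'.op ≫ a)
  rw [← nat x (θ.op ≫ a) (⦋0⦌.const c.unop 0).op, ← nat x (θ'.op ≫ a) (⦋0⦌.const c.unop 0).op]
  exact congrArg _ (vertex x _ _)

theorem mapSpace.post_app_post_app (Q : SPre.{u} H) {R R' R'' : SPre.{u} H} (g : R ⟶ R')
    (g' : R' ⟶ R'') {n : SimplexCategoryᵒᵖ} (x : (mapSpace Q R).obj n) :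
    (mapSpace.post Q g').app n ((mapSpace.post Q g).app n x) =
      (mapSpace.post Q (g ≫ g')).app n x := by
  rw [← mapSpace.post_comp]
  rfl

theorem mapSpace.post_app_pre_app {Q Q' : SPre.{u} H} (h : Q ⟶ Q') {R R' : SPre.{u} H}
    (g : R ⟶ R') {n : SimplexCategoryᵒᵖ} (x : (mapSpace Q' R).obj n) :
    (mapSpace.post Q g).app n ((mapSpace.pre h R).app n x) =
      (mapSpace.pre h R').app n ((mapSpace.post Q' g).app n x) := by
  have e := NatTrans.congr_app (mapSpace.pre_post h g) n
  exact ConcreteCategory.congr_hom e x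

/-! ## Points of formal completions -/

section

variable {κ : Kind} {A B : SPre.{u} H} {f : A ⟶ B} (Q : CofibrantModel κ f) (R : SPre.{u} H)
  {P : Type u} [Preorder P] (ι : P →o Ideal (piZero κ R).Ring)

/-- The point of `X(π₀(R)/I_p) ×_{Y(π₀(R)/I_p)} Y(R)` given by a point of `X(R)`. -/
def completionPoint (p : P) (x : (mapSpace Q.QB R) _⦋0⦌) :
    ((completionDiagram Q R ι).obj p) _⦋0⦌ :=
  (hoPullback.lift (mapSpace.post Q.QB (toDiscreteQuot κ R (ι p))) (mapSpace.pre Q.Qf R)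
      (mapSpace.pre_post _ _).symm).app _ x

theorem mapπ₀_toCompletion_mk (p : P) (x : (mapSpace Q.QB R) _⦋0⦌) :
    SSet.mapπ₀ (toCompletion Q R ι p) (SSet.π₀.mk x) =
      hoColim.class.{u + 1, u} (completionDiagram Q R ι) p (completionPoint Q R ι p x) :=
  rfl

theorem completionPoint_fst (p : P) (x : (mapSpace Q.QB R) _⦋0⦌) :
    (completionPoint Q R ι p x).1.1 =
      (mapSpace.post Q.QB (toDiscreteQuot κ R (ι p))).app _ x :=
  hoPullback.lift_app_fst _ _ _ x

theorem completionPoint_snd (p : P) (x : (mapSpace Q.QB R) _⦋0⦌) :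
    (completionPoint Q R ι p x).1.2.2 = (mapSpace.pre Q.Qf R).app _ x :=
  hoPullback.lift_app_snd _ _ (mapSpace.pre_post _ _).symm x

variable {R} in
theorem completionDiagram_map_fst {p q : P} (h : p ⟶ q)
    (t : ((completionDiagram Q R ι).obj p) _⦋0⦌) :
    (((completionDiagram Q R ι).map h).app _ t).1.1 = (mapSpace.post Q.QB
      (discreteQuotMap κ R (homOfLE (ι.monotone (leOfHom h))))).app _ t.1.1 :=
  hoPullback.map_app_fst (mapSpace.post Q.QB _) (mapSpace.post Q.QA _) (mapSpace.pre_post _ _)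
    ((mapSpace.post_comp _ _ _).trans (congrArg _ (toDiscreteQuot_map κ R _))) t

variable {R} in
theorem completionDiagram_map_snd {p q : P} (h : p ⟶ q)
    (t : ((completionDiagram Q R ι).obj p) _⦋0⦌) :
    (((completionDiagram Q R ι).map h).app _ t).1.2.2 = t.1.2.2 :=
  hoPullback.map_app_snd (mapSpace.post Q.QB
    (discreteQuotMap κ R (homOfLE (ι.monotone (leOfHom h))))) (mapSpace.post Q.QA _)
    (mapSpace.pre_post _ _)
    ((mapSpace.post_comp _ _ _).trans (congrArg _ (toDiscreteQuot_map κ R _))) t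

theorem post_toDiscreteQuot {p q : P} (h : p ⟶ q) (x : (mapSpace Q.QB R) _⦋0⦌) :
    (mapSpace.post Q.QB (discreteQuotMap κ R (homOfLE (ι.monotone (leOfHom h))))).app _
      ((mapSpace.post Q.QB (toDiscreteQuot κ R (ι p))).app _ x) =
      (mapSpace.post Q.QB (toDiscreteQuot κ R (ι q))).app _ x := by
  rw [mapSpace.post_app_post_app, toDiscreteQuot_map]

/-- Over a discrete base the path is determined by the two coordinates, so only these have to be
compared. -/
theorem map_completionPoint {p q : P} (h : p ⟶ q) (x : (mapSpace Q.QB R) _⦋0⦌) :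
    ((completionDiagram Q R ι).map h).app _ (completionPoint Q R ι p x) =
      completionPoint Q R ι q x := by
  refine hoPullback_ext (isDiscrete_mapSpace_const _ _) ?_ ?_
  · refine (completionDiagram_map_fst Q ι h _).trans (Eq.trans ?_ (completionPoint_fst ..).symm)
    rw [completionPoint_fst]
    exact post_toDiscreteQuot Q R ι h x
  · exact (completionDiagram_map_snd Q ι h _).trans
      ((completionPoint_snd ..).trans (completionPoint_snd ..).symm)

/-- The points given by `x` are compatible along the diagram. The canonical map, defined through the
zero ideal, can therefore be evaluated in any term above it. -/
theorem class_completionPoint {p q : P} (h : p ⟶ q) (x : (mapSpace Q.QB R) _⦋0⦌) :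
    hoColim.class.{u + 1, u} (completionDiagram Q R ι) q (completionPoint Q R ι q x) =
      hoColim.class.{u + 1, u} (completionDiagram Q R ι) p (completionPoint Q R ι p x) := by
  rw [← map_completionPoint Q R ι h]
  exact hoColim.class_map.{u + 1, u} _ h _

/-! ### Comparison of the PD completion with the de Rham completion. -/

instance (A : Type u) [CommRing A] : IsDirectedOrder (NilIdeal A) where
  directed I J := ⟨⟨I.1 ⊔ J.1, by
    -- Ideals form a commutative semiring, in which the sum of two nilpotent elements is nilpotent.
    rw [← Submodule.add_eq_sup]
    exact (Commute.all _ _).isNilpotent_add I.2 J.2⟩, le_sup_left (a := I.1), le_sup_right (a := I.1)⟩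

/-- Every divided power structure takes the same values at `0`: the zeroth power is `1` and the
others are `0`. -/
theorem PDNilIdeal.zero_le {A : Type u} [CommRing A] (I : PDNilIdeal A) :
    PDNilIdeal.zero A ≤ I := by
  refine ⟨bot_le, fun n a ha => ?_⟩
  obtain rfl : a = 0 := ha
  rcases eq_or_ne n 0 with rfl | hn
  · rw [I.pd.dpow_zero (zero_mem _), (PDNilIdeal.zero A).pd.dpow_zero (zero_mem _)]
  · rw [I.pd.dpow_eval_zero hn, (PDNilIdeal.zero A).pd.dpow_eval_zero hn]

/-- The comparison map from the PD completion to the de Rham completion, on components. -/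
def crysToDeRham : SSet.π₀ (crysCompletion Q R) → SSet.π₀ (deRhamCompletion Q R) :=
  hoColim.desc.{u + 1, u} (completionDiagram Q R (PDNilIdeal.toIdeal (piZero κ R).Ring))
    -- The terms of the diagrams depend on the ideal only, so `t` is itself a point of the de Rham
    -- term at the underlying ideal.
    (fun p t => hoColim.class.{u + 1, u}
      (completionDiagram Q R (NilIdeal.toIdeal (piZero κ R).Ring)) ⟨p.ideal, p.nilpotent⟩ t)
    (fun p _ _ h => hoColim.class_eq_of_mk_eq.{u + 1, u}
      (completionDiagram Q R (NilIdeal.toIdeal (piZero κ R).Ring))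
      (p := ⟨p.ideal, p.nilpotent⟩) h)
    (fun {p q} h t => hoColim.class_map.{u + 1, u}
      (completionDiagram Q R (NilIdeal.toIdeal (piZero κ R).Ring))
      (p := ⟨p.ideal, p.nilpotent⟩) (q := ⟨q.ideal, q.nilpotent⟩) (homOfLE (leOfHom h).1) t)

theorem crysToDeRham_mapπ₀ (x : SSet.π₀ (mapSpace Q.QB R)) :
    crysToDeRham Q R (SSet.mapπ₀ (toCrysCompletion Q R) x) =
      SSet.mapπ₀ (toDeRhamCompletion Q R) x := by
  induction x with
  | mk x => rfl

/-! ### Descent of agreement from a larger nilpotent ideal to a smaller one. -/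

variable {R}

/-- If points of `X` with values in nilpotent thickenings of `π₀(R)/I` are determined by their
images in the de Rham completion, then a point of `X(π₀(R)/I)` is determined by its images in
`X(π₀(R)/J)` and in `Y(π₀(R)/I)`. -/
theorem eq_of_post_eq_of_pre_eq (hR : IsSimpInd κ R) {I J : Ideal (piZero κ R).Ring} (h : I ⟶ J)
    (hJ : IsNilpotent J)
    (hinj : Function.Injective (SSet.mapπ₀ (toDeRhamCompletion Q (discreteQuot κ R I))))
    {x y : (mapSpace Q.QB (discreteQuot κ R I)) _⦋0⦌}
    (h₁ : (mapSpace.post Q.QB (discreteQuotMap κ R h)).app _ x =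
      (mapSpace.post Q.QB (discreteQuotMap κ R h)).app _ y)
    (h₂ : (mapSpace.pre Q.Qf (discreteQuot κ R I)).app _ x =
      (mapSpace.pre Q.Qf (discreteQuot κ R I)).app _ y) : x = y := by
  obtain ⟨J', hJ', g, hg⟩ := exists_nilpotent_refinement hR h hJ
  -- Points of a discrete space are equal if their components are, so injectivity on components for
  -- the algebra `π₀(R)/I` is enough.
  apply (isDiscrete_mapSpace_const _ _).eq_of_mk_eq
  apply hinj
  let E := discreteQuot κ R I
  let ι := NilIdeal.toIdeal (piZero κ E).Ring
  let p : NilIdeal (piZero κ E).Ring := ⟨J', hJ'⟩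
  have hp : NilIdeal.zero _ ⟶ p := homOfLE (bot_le (a := J'))
  have key : ∀ z : (mapSpace Q.QB E) _⦋0⦌,
      (mapSpace.post Q.QB (toDiscreteQuot κ E J')).app _ z =
        (mapSpace.post Q.QB g).app _ ((mapSpace.post Q.QB (discreteQuotMap κ R h)).app _ z) := by
    intro z
    rw [← hg, mapSpace.post_app_post_app]
  -- At the nilpotent ideal `J'` the two points coincide: their first coordinates factor through
  -- `X(π₀(R)/J)`, where `h₁` applies, and their second coordinates agree by `h₂`.
  have e : completionPoint Q E ι p x = completionPoint Q E ι p y := by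
    refine hoPullback_ext (isDiscrete_mapSpace_const _ _) ?_ ?_
    · refine (completionPoint_fst ..).trans (Eq.trans ?_ (completionPoint_fst ..).symm)
      exact (key x).trans ((congrArg _ h₁).trans (key y).symm)
    · exact (completionPoint_snd ..).trans (h₂.trans (completionPoint_snd ..).symm)
  refine (mapπ₀_toCompletion_mk Q E ι (NilIdeal.zero _) x).trans
    (Eq.trans ?_ (mapπ₀_toCompletion_mk Q E ι (NilIdeal.zero _) y).symm)
  rw [← class_completionPoint Q E ι hp, ← class_completionPoint Q E ι hp, e]

/-- If `t` and the point given by `x` agree up to a path after passing to a nilpotent ideal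
`I_q`, then they do so already for `I_p`. -/
theorem mk_completionPoint_eq (hR : IsSimpInd κ R) {p q : P} (h : p ⟶ q)
    (hq : IsNilpotent (ι q))
    (hinj : Function.Injective (SSet.mapπ₀ (toDeRhamCompletion Q (discreteQuot κ R (ι p)))))
    (x : (mapSpace Q.QB R) _⦋0⦌) (t : ((completionDiagram Q R ι).obj p) _⦋0⦌)
    (e : SSet.π₀.mk (completionPoint Q R ι q x) =
      SSet.π₀.mk (((completionDiagram Q R ι).map h).app _ t)) :
    SSet.π₀.mk (completionPoint Q R ι p x) = SSet.π₀.mk t := by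
  -- Agreement on components gives equality of the first coordinates, which lie in a discrete space.
  -- The second coordinates lie in `Y(R)`, so for them it gives only equality of components.
  have e₁ : (mapSpace.post Q.QB (toDiscreteQuot κ R (ι q))).app _ x =
      (mapSpace.post Q.QB (discreteQuotMap κ R (homOfLE (ι.monotone (leOfHom h))))).app _ t.1.1 :=
    (completionPoint_fst ..).symm.trans
      ((hoPullback_fst_eq (isDiscrete_mapSpace_const _ _) e).trans
        (completionDiagram_map_fst Q ι h t))
  have e₂ : SSet.π₀.mk ((mapSpace.pre Q.Qf R).app _ x) = SSet.π₀.mk t.1.2.2 :=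
    (congrArg SSet.π₀.mk (completionPoint_snd Q R ι q x)).symm.trans
      ((hoPullback_snd_eq e).trans (congrArg SSet.π₀.mk (completionDiagram_map_snd Q ι h t)))
  refine hoPullback_mk_eq (isDiscrete_mapSpace_const _ _) _ _ ?_
    ((congrArg SSet.π₀.mk (completionPoint_snd Q R ι p x)).trans e₂)
  refine (completionPoint_fst Q R ι p x).trans ?_
  refine eq_of_post_eq_of_pre_eq Q hR (homOfLE (ι.monotone (leOfHom h))) hq hinj
    ((post_toDiscreteQuot Q R ι h x).trans e₁) ?_
  -- The images in `Y(π₀(R)/I_p)` also agree: that of `t.1.1` equals the image of its second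
  -- coordinate, and a path in `Y(R)` becomes an equality in the discrete space `Y(π₀(R)/I_p)`.
  refine Eq.trans ?_ (hoPullback_compat (isDiscrete_mapSpace_const _ _) t).symm
  refine (mapSpace.post_app_pre_app Q.Qf (toDiscreteQuot κ R (ι p)) x).symm.trans ?_
  have e₃ := congrArg (SSet.mapπ₀ (mapSpace.post Q.QA (toDiscreteQuot κ R (ι p)))) e₂
  rw [SSet.mapπ₀_mk, SSet.mapπ₀_mk] at e₃
  exact (isDiscrete_mapSpace_const _ _).eq_of_mk_eq e₃

/-- If `X(R) → Y_{X,dR}(R)` is surjective on components, and injective for the quotients of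
`π₀(R)`, then for every nilpotent ideal `I` each component of
`X(π₀(R)/I) ×_{Y(π₀(R)/I)} Y(R)` comes from a point of `X(R)`. -/
theorem exists_completionPoint (hR : IsSimpInd κ R)
    (hsurj : Function.Surjective (SSet.mapπ₀ (toDeRhamCompletion Q R)))
    (hinj : ∀ I, Function.Injective (SSet.mapπ₀ (toDeRhamCompletion Q (discreteQuot κ R I))))
    (p : NilIdeal (piZero κ R).Ring)
    (t : ((completionDiagram Q R (NilIdeal.toIdeal _)).obj p) _⦋0⦌) :
    ∃ x : (mapSpace Q.QB R) _⦋0⦌,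
      SSet.π₀.mk (completionPoint Q R (NilIdeal.toIdeal _) p x) = SSet.π₀.mk t := by
  let ι := NilIdeal.toIdeal (piZero κ R).Ring
  obtain ⟨x, hx⟩ := hsurj (hoColim.class.{u + 1, u} (completionDiagram Q R ι) p t)
  induction x with
  | mk x =>
  -- The class of `x` enters through the zero ideal and that of `t` through `p`; directedness
  -- provides a nilpotent ideal `q` above both at which they agree.
  obtain ⟨q, h₀, hp, e⟩ := hoColim.exists_of_class_eq.{u + 1, u} (completionDiagram Q R ι)
    ((mapπ₀_toCompletion_mk Q R ι (NilIdeal.zero _) x).symm.trans hx)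
  rw [map_completionPoint] at e
  exact ⟨x, mk_completionPoint_eq Q ι hR hp q.2 (hinj _) x t e⟩

end

end IndBanach

/-- Over a Banach ring `H` and in each of the categories of (essentially monomorphic) ind-Banach
`H`-modules, let `f : A ⟶ B` be a morphism of simplicial commutative ind-Banach algebras, with a
cofibrant model `Q` that computes the mapping spaces. If `f` is de Rham intrinsic étale, then it
is PD intrinsic étale. -/
theorem mainTheorem9 {H : Type u} [NormedCommRing H] [CompleteSpace H] (κ : IndBanach.Kind)
    (A B : IndBanach.SPre.{u} H) (hA : IndBanach.IsSimpInd κ A) (hB : IndBanach.IsSimpInd κ B)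
    (f : A ⟶ B) (Q : IndBanach.CofibrantModel κ f)
    (hf : IndBanach.IsDeRhamIntrinsicEtale κ f Q) : IndBanach.IsPDIntrinsicEtale κ f Q := by
  refine ⟨hf.1, fun R hR => ⟨fun x y h => (hf.2 R hR).1 ?_, fun z => ?_⟩⟩
  -- Injectivity: the de Rham map on components factors through the PD map.
  · rw [← IndBanach.crysToDeRham_mapπ₀, h, IndBanach.crysToDeRham_mapπ₀]
  · obtain ⟨p, t, rfl⟩ := IndBanach.hoColim.class_surjective.{u + 1, u} _ z
    -- Surjectivity: the de Rham condition is used for `R` itself and for every discrete quotient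
    -- `π₀(R)/I`. The agreement obtained is in the term at `p.ideal`, so the divided powers on it
    -- play no role.
    obtain ⟨x, hx⟩ := IndBanach.exists_completionPoint Q hR (hf.2 R hR).2
      (fun I => (hf.2 _ fun _ => IndBanach.isInd_modIdeal (IndBanach.isInd_piZero hR) I).1)
      ⟨p.ideal, p.nilpotent⟩ t
    refine ⟨SSet.π₀.mk x, ?_⟩
    refine (IndBanach.mapπ₀_toCompletion_mk Q R (IndBanach.PDNilIdeal.toIdeal _) (IndBanach.PDNilIdeal.zero _) x).trans ?_
    -- As the zero ideal is the least PD ideal, the image of `x` can be computed at `p`, where it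
    -- meets `t`.
    rw [← IndBanach.class_completionPoint Q R (IndBanach.PDNilIdeal.toIdeal _) (homOfLE p.zero_le)]
    exact IndBanach.hoColim.class_eq_of_mk_eq.{u + 1, u} _ hx
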